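/- Let $k\ge 1$ and let $\Lambda$ be a row-finite, locally convex $k$-graph: a countable category with a degree functor $d:\Lambda\to\mathbb N^k$ having the unique factorisation property, such that every vertex $v\in\Lambda^0$ is the range of only finitely many edges, and such that if $\mu\in v\Lambda^{e_i}$, $\nu\in v\Lambda^{e_j}$ with $i\ne j$, then $s(\mu)\Lambda^{e_j}$ and $s(\nu)\Lambda^{e_i}$ are nonempty. (Here $v\Lambda^{e_i}$ is the set of edges of colour $i$ with range $v$.) A representation $L$ of $\mathcal O_\Lambda$ is a Hilbert space $L$ with bounded operators $(X_\lambda)_{\lambda\in\Lambda}$ such that the $X_v$, $v\in\Lambda^0$, are mutually orthogonal projections with $\sum_v X_v=1$ strongly, $X_\lambda^*X_\lambda=X_{s(\lambda)}$, $X_\lambda X_\mu=X_{\lambda\mu}$ for composable $\lambda,\mu$, and $X_v=\sum_{\lambda\in v\Lambda^{e_i}}X_\lambda X_\lambda^*$ whenever $v\Lambda^{e_i}\neq\emptyset$. An $\mathcal A_\Lambda$-module is a Hilbert space $H$ with bounded operators $(A_\lambda)_{\lambda\in\Lambda}$ such that the $A_v$ are mutually orthogonal projections with $\sum_vA_v=1$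 strongly, $A_\mu A_\lambda=A_{\lambda\mu}$ for composable $\lambda,\mu$, and $\sum_{\lambda\in v\Lambda^{e_i}}A_\lambda^*A_\lambda=A_v$ whenever $v\Lambda^{e_i}\ne\emptyset$; its dimension vector is $\dim_\Lambda(H):v\mapsto\dim(A_vH)\in\mathbb N\cup\{\infty\}$. Each representation $L$ gives a module $UL$, namely $L$ with $A_\lambda=X_\lambda^*$. Isomorphisms of representations are invertible bounded linear maps intertwining all $X_\lambda$ and $X_\lambda^*$. For a module $H$, let $\Pi(H)$ be the following representation of $\mathcal O_\Lambda$. Write $\Lambda^{\le n}$ ($n\in\mathbb N^k$) for the set of paths $\tau$ with $d(\tau)\le n$ such that $s(\tau)\Lambda^{e_i}=\emptyset$ whenever $d(\tau)_i<n_i$. The Hilbert space of $\Pi(H)$ is the separated completion of the space of formal sums of pairs $(\lambda,\xi)$, $\lambda\in\Lambda$, $\xi\in A_{s(\lambda)}H$ (linear in $\xi$), for the positive semidefinite form $\langle(\lambda,\xi),(\mu,\eta)\rangle=\sum\langle A_\nu\xi,A_\gamma\eta\rangle$, the sum being over all $\nu,\gamma$ with $\lambda\nu=\mu\gamma\in\Lambda^{\le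 d(\lambda)+d(\mu)}$; with $[\lambda,\xi]$ the class of $(\lambda,\xi)$, the operators are given by $X_\mu[\lambda,\xi]=[\mu\lambda,\xi]$ if $s(\mu)=r(\lambda)$ and $X_\mu[\lambda,\xi]=0$ otherwise. The representation $L$ has finite Pythagorean dimension if $L\simeq\Pi(K)$ for some finite dimensional module $K$. Trees at $v$ are the finite sets of paths with range $v$ obtained from $\{v\}$ by repeatedly replacing an element $\mu$ by all $\mu\alpha$, $\alpha\in s(\mu)\Lambda^{e_i}$, for some $i$ with $s(\mu)\Lambda^{e_i}\neq\emptyset$. A submodule of $H$ is a closed subspace invariant under all $A_\lambda$; a submodule $H'\subset H$ is complete if for all $\varepsilon>0$, $v\in\Lambda^0$ and $\xi\in A_vH$ there are a tree $t$ at $v$ and vectors $\eta_\mu\in H'$ ($\mu\in t$) with $\sum_{\mu\in t}\|A_\mu\xi-\eta_\mu\|^2<\varepsilon^2$. Let $L$ be a representation of $\mathcal O_\Lambda$ of finite Pythagorean dimension. Then $UL$ has a smallest complete submodule $\Sigma(L)$, and the following three vectors in $(\mathbb N\cup\{\infty\})^{\Lambda^0}$ are well defined and equal: 1. $\dim_\Lambda(\Sigma(L))$;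 2. the coordinatewise minimum of $\{\dim_\Lambda(K): K \text{ an } \mathcal A_\Lambda\text{-module with } \Pi(K)\simeq L\}$; 3. the coordinatewise minimum of $\{\dim_\Lambda(H'): H'\subset UL\text{ a complete submodule}\}$. Both minima are attained in all coordinates simultaneously, i.e. they are least elements of these sets for the coordinatewise order. The common vector (the Pythagorean dimension vector of $L$) is an invariant of $L$: isomorphic representations have the same one. -/

import Mathlib

open CategoryTheory ContinuousLinearMap

universe v u w w'

noncomputable section

/-- A `k`-graph: a countable small category with object set `V`, together with a degree functor
to `ℕ^k` that has the unique factorisation property.  A morphism `f : a ⟶ b` is a path with source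
`a` and range `b`; the composite `λ ∘ μ` is `μ ≫ λ`. -/
structure KGraph (k : ℕ) (V : Type u) [Category.{v} V] where
  countable_vertices : Countable V
  countable_paths : ∀ a b : V, Countable (a ⟶ b)
  deg : ∀ {a b : V}, (a ⟶ b) → (Fin k → ℕ)
  deg_id : ∀ a : V, deg (𝟙 a) = 0
  deg_comp : ∀ {a b c : V} (g : a ⟶ b) (f : b ⟶ c), deg (g ≫ f) = deg f + deg g
  factorisation : ∀ {a c : V} (h : a ⟶ c) (m n : Fin k → ℕ), deg h = m + n →
    ∃! p : Σ b : V, (a ⟶ b) × (b ⟶ c), p.2.1 ≫ p.2.2 = h ∧ deg p.2.2 = m ∧ deg p.2.1 = n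

/-- `PathInto a` is the set of all paths with range `a`. -/
abbrev PathInto {V : Type u} [Category.{v} V] (a : V) : Type (max u v) := Σ b : V, (b ⟶ a)

/-- The composite `μ ∘ α` of a path `μ` with range `a` and a path `α` with range the source of
`μ`. -/
abbrev PathInto.extend {V : Type u} [Category.{v} V] {a : V} (μ : PathInto a)
    (α : PathInto μ.1) : PathInto a := ⟨α.1, α.2 ≫ μ.2⟩

/-- The composite `f ∘ p`. -/
abbrev PathInto.push {V : Type u} [Category.{v} V] {a b : V} (f : a ⟶ b) (p : PathInto a) :
    PathInto b := ⟨p.1, p.2 ≫ f⟩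

namespace KGraph

variable {k : ℕ} {V : Type u} [Category.{v} V] (Λ : KGraph k V)

/-- The edges of colour `i` with range `a`. -/
abbrev Edge (a : V) (i : Fin k) : Type (max u v) :=
  {p : PathInto a // Λ.deg p.2 = Pi.single i 1}

/-- Every vertex is the range of finitely many edges. -/
class RowFinite : Prop where
  finite : ∀ a : V, Finite {p : PathInto a // ∃ i : Fin k, Λ.deg p.2 = Pi.single i 1}

/-- If `e` and `e'` are edges of distinct colours `i`, `j` with the same range, then the source of
`e` receives an edge of colour `j` (and, by symmetry, that of `e'` one of colour `i`). -/
class LocallyConvex : Prop where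
  nonempty : ∀ (a : V) (i j : Fin k), i ≠ j → ∀ e : Λ.Edge a i,
    Nonempty (Λ.Edge a j) → Nonempty (Λ.Edge e.1.1 j)

instance [h : Λ.RowFinite] (a : V) (i : Fin k) : Fintype (Λ.Edge a i) :=
  haveI := h.finite a
  haveI : Finite (Λ.Edge a i) := Finite.of_injective
    (fun e => (⟨e.1, i, e.2⟩ : {p : PathInto a // ∃ i : Fin k, Λ.deg p.2 = Pi.single i 1}))
    (fun _ _ h => Subtype.ext (congrArg (fun x => x.1) h))
  Fintype.ofFinite _

open Classical in
/-- The basic caret of colour `i` at `a`: all edges of colour `i` with range `a` if there are any,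
and the trivial path at `a` otherwise. -/
def caret [Λ.RowFinite] (a : V) (i : Fin k) : Finset (PathInto a) :=
  if Nonempty (Λ.Edge a i) then Finset.univ.image (fun e : Λ.Edge a i => e.1) else {⟨a, 𝟙 a⟩}

open Classical in
/-- The trees at `a`, as finite sets of paths with range `a`: they are obtained from the trivial
tree by repeatedly gluing a basic caret at a leaf. -/
inductive IsTree [Λ.RowFinite] (a : V) : Finset (PathInto a) → Prop
  | trivial : IsTree a {⟨a, 𝟙 a⟩}
  | glue (t : Finset (PathInto a)) (μ : PathInto a) (i : Fin k) : IsTree a t → μ ∈ t →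
      IsTree a (t.erase μ ∪ (Λ.caret μ.1 i).image μ.extend)

end KGraph

/-- An object of `Mod(A_Λ)`: a complex Hilbert space `H` with operators `A_λ`, `λ ∈ Λ`, such that
the `A_v` (`v` a vertex) are mutually orthogonal projections, `A_μ A_λ = A_{λ ∘ μ}`,
`∑_{λ ∈ vΛ^{e_i}} A_λ^* A_λ = A_v` whenever `vΛ^{e_i}` is nonempty, and which is nondegenerate. -/
structure ALMod {k : ℕ} {V : Type u} [Category.{v} V] (Λ : KGraph k V) [Λ.RowFinite] where
  H : Type w
  [normed : NormedAddCommGroup H]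
  [innerProd : InnerProductSpace ℂ H]
  [complete : CompleteSpace H]
  A : ∀ {a b : V}, (a ⟶ b) → (H →L[ℂ] H)
  isStarProjection : ∀ a : V, IsStarProjection (A (𝟙 a))
  orthogonal : ∀ a b : V, a ≠ b → A (𝟙 a) ∘L A (𝟙 b) = 0
  map_comp : ∀ {a b c : V} (g : a ⟶ b) (f : b ⟶ c), A (g ≫ f) = A g ∘L A f
  sum_adjoint_comp : ∀ (a : V) (i : Fin k), Nonempty (Λ.Edge a i) →
    ∑ e : Λ.Edge a i, adjoint (A e.1.2) ∘L A e.1.2 = A (𝟙 a)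
  nondegenerate : ∀ ξ : H, HasSum (fun a : V => A (𝟙 a) ξ) ξ

/-- An object of `Rep(O_Λ)`: a complex Hilbert space `L` with operators `X_λ`, `λ ∈ Λ`, satisfying
the defining relations of the higher-rank graph C*-algebra `O_Λ`, and nondegenerate. By the
universal property of `O_Λ` this is the same as a nondegenerate representation of `O_Λ`. -/
structure OLRep {k : ℕ} {V : Type u} [Category.{v} V] (Λ : KGraph k V) [Λ.RowFinite] where
  L : Type w
  [normed : NormedAddCommGroup L]
  [innerProd : InnerProductSpace ℂ L]
  [complete : CompleteSpace L]
  X : ∀ {a b : V}, (a ⟶ b) → (L →L[ℂ] L)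
  isStarProjection : ∀ a : V, IsStarProjection (X (𝟙 a))
  orthogonal : ∀ a b : V, a ≠ b → X (𝟙 a) ∘L X (𝟙 b) = 0
  adjoint_comp_self : ∀ {a b : V} (f : a ⟶ b), adjoint (X f) ∘L X f = X (𝟙 a)
  sum_comp_adjoint : ∀ (a : V) (i : Fin k), Nonempty (Λ.Edge a i) →
    X (𝟙 a) = ∑ e : Λ.Edge a i, X e.1.2 ∘L adjoint (X e.1.2)
  map_comp : ∀ {a b c : V} (g : a ⟶ b) (f : b ⟶ c), X f ∘L X g = X (g ≫ f)
  nondegenerate : ∀ ξ : L, HasSum (fun a : V => X (𝟙 a) ξ) ξ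

attribute [instance] ALMod.normed ALMod.innerProd ALMod.complete
attribute [instance] OLRep.normed OLRep.innerProd OLRep.complete

namespace ALMod

variable {k : ℕ} {V : Type u} [Category.{v} V] {Λ : KGraph k V} [Λ.RowFinite]
variable (M : ALMod.{v, u, w} Λ)

/-- The subspace `H_a = A_a H`. -/
def fiber (a : V) : Submodule ℂ M.H := LinearMap.range (M.A (𝟙 a)).toLinearMap

/-- The dimension vector `a ↦ dim H_a`, with values in `ℕ ∪ {∞}`. -/
def dimVec (a : V) : ℕ∞ := Cardinal.toENat (Module.rank ℂ (M.fiber a))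

/-- Submodules are closed subspaces that are invariant under all the `A_λ`. -/
structure IsSubmodule (S : Submodule ℂ M.H) : Prop where
  isClosed : IsClosed (S : Set M.H)
  map_mem : ∀ {a b : V} (f : a ⟶ b), ∀ ξ ∈ S, M.A f ξ ∈ S

/-- Complete submodules: for every vertex `a` and `ξ ∈ H_a` there are trees `t` at `a` for which
`(A_μ ξ)_{μ ∈ t}` comes arbitrarily close to tuples of vectors of the submodule. -/
structure IsCompleteSubmodule (S : Submodule ℂ M.H) : Prop extends M.IsSubmodule S where
  exists_tree : ∀ ε : ℝ, 0 < ε → ∀ a : V, ∀ ξ ∈ M.fiber a,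
    ∃ t : Finset (PathInto a), Λ.IsTree a t ∧ ∃ η : PathInto a → M.H,
      (∀ μ ∈ t, η μ ∈ S) ∧ ∑ μ ∈ t, ‖M.A μ.2 ξ - η μ‖ ^ 2 < ε ^ 2

variable {M}

/-- A submodule, regarded as a module. -/
def restrict {S : Submodule ℂ M.H} (hS : M.IsSubmodule S) : ALMod.{v, u, w} Λ :=
  haveI : CompleteSpace S := hS.isClosed.completeSpace_coe
  { H := S
    A := fun f => (M.A f).restrict (hS.map_mem f)
    isStarProjection := fun a => by
      refine ⟨?_, ?_⟩
      · ext x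
        have := congrArg (fun T : M.H →L[ℂ] M.H => T x) (M.isStarProjection a).isIdempotentElem
        simpa using this
      · rw [isSelfAdjoint_iff_isSymmetric]
        intro x y
        have := (isSelfAdjoint_iff_isSymmetric.1 (M.isStarProjection a).isSelfAdjoint) x y
        simpa using this
    orthogonal := fun a b hab => by
      ext x
      have := congrArg (fun T : M.H →L[ℂ] M.H => T x) (M.orthogonal a b hab)
      simpa using this
    map_comp := fun g f => by
      ext x
      have := congrArg (fun T : M.H →L[ℂ] M.H => T x) (M.map_comp g f)
      simpa using this
    sum_adjoint_comp := fun a i hi => by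
      ext1 x
      refine ext_inner_right ℂ fun y => ?_
      have := congrArg (fun T : M.H →L[ℂ] M.H => inner ℂ (T x) (y : M.H))
        (M.sum_adjoint_comp a i hi)
      simp only [sum_apply, sum_inner, ContinuousLinearMap.comp_apply,
        adjoint_inner_left] at this ⊢
      simpa using this
    nondegenerate := fun ξ => by
      rw [← Topology.IsInducing.subtypeVal.hasSum_iff (g := S.subtype)]
      exact M.nondegenerate ξ }

end ALMod

namespace OLRep

variable {k : ℕ} {V : Type u} [Category.{v} V] {Λ : KGraph k V} [Λ.RowFinite]

/-- The forgetful functor `U : Rep(O_Λ) → Mod(A_Λ)` on objects: `A_λ = X_λ^*`. -/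
def toMod (ρ : OLRep.{v, u, w} Λ) : ALMod.{v, u, w} Λ where
  H := ρ.L
  A := fun f => adjoint (ρ.X f)
  isStarProjection := fun a => by
    have := (ρ.isStarProjection a).isSelfAdjoint.adjoint_eq
    rw [this]; exact ρ.isStarProjection a
  orthogonal := fun a b hab => by
    rw [← adjoint_comp, ρ.orthogonal b a hab.symm]; simp
  map_comp := fun g f => by rw [← adjoint_comp, ρ.map_comp]
  sum_adjoint_comp := fun a i hi => by
    rw [(ρ.isStarProjection a).isSelfAdjoint.adjoint_eq, ρ.sum_comp_adjoint a i hi]; simp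
  nondegenerate := fun ξ => by
    have (a : V) := (ρ.isStarProjection a).isSelfAdjoint.adjoint_eq
    simp only [this]; exact ρ.nondegenerate ξ

/-- Isomorphism in `Rep(O_Λ)`: an invertible bounded linear map that intertwines the actions of
`O_Λ`, that is, of all `X_λ` and all `X_λ^*`. -/
def Isomorphic (ρ : OLRep.{v, u, w} Λ) (σ : OLRep.{v, u, w'} Λ) : Prop :=
  ∃ φ : ρ.L ≃L[ℂ] σ.L, ∀ {a b : V} (f : a ⟶ b),
    (∀ x, φ (ρ.X f x) = σ.X f (φ x)) ∧
    (∀ x, φ (adjoint (ρ.X f) x) = adjoint (σ.X f) (φ x))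

end OLRep

namespace KGraph

variable {k : ℕ} {V : Type u} [Category.{v} V] (Λ : KGraph k V)

theorem factor_unique {a b b' c : V} {g : a ⟶ b} {f : b ⟶ c} {g' : a ⟶ b'} {f' : b' ⟶ c}
    (h : g ≫ f = g' ≫ f') (hd : Λ.deg f = Λ.deg f') :
    (⟨b, g, f⟩ : Σ b : V, (a ⟶ b) × (b ⟶ c)) = ⟨b', g', f'⟩ := by
  have h1 : Λ.deg g = Λ.deg g' := by
    have := congrArg Λ.deg h
    rw [Λ.deg_comp, Λ.deg_comp, hd] at this
    exact add_left_cancel this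
  exact (Λ.factorisation (g ≫ f) (Λ.deg f) (Λ.deg g) (Λ.deg_comp g f)).unique
    ⟨rfl, rfl, rfl⟩ ⟨h.symm, hd.symm, h1.symm⟩

theorem cancel (Λ : KGraph k V) {a b c : V} {g g' : a ⟶ b} {f : b ⟶ c} (h : g ≫ f = g' ≫ f) : g = g' := by
  have := Λ.factor_unique h rfl
  simpa using this

theorem exists_factor {a c : V} (h : a ⟶ c) {m : Fin k → ℕ} (hm : m ≤ Λ.deg h) :
    ∃ (b : V) (g : a ⟶ b) (f : b ⟶ c), g ≫ f = h ∧ Λ.deg f = m := by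
  obtain ⟨p, hp, -⟩ := Λ.factorisation h m (Λ.deg h - m) (add_tsub_cancel_of_le hm).symm
  exact ⟨p.1, p.2.1, p.2.2, hp.1, hp.2.1⟩

theorem single_le_iff {m : Fin k → ℕ} {i : Fin k} : Pi.single i 1 ≤ m ↔ 0 < m i := by
  constructor
  · intro h
    have := h i
    simp at this
    omega
  · intro h j
    by_cases hj : j = i
    · subst hj; simpa [Nat.one_le_iff_ne_zero, Nat.pos_iff_ne_zero] using h
    · simp [hj]

/-- A path of positive degree in colour `i` starts (at its range) with an edge of colour `i`. -/
theorem exists_edge {a c : V} (h : a ⟶ c) {i : Fin k} (hi : 0 < Λ.deg h i) :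
    ∃ (e : Λ.Edge c i) (g : a ⟶ e.1.1), g ≫ e.1.2 = h := by
  obtain ⟨b, g, f, h1, h2⟩ := Λ.exists_factor h (single_le_iff.2 hi)
  exact ⟨⟨⟨b, f⟩, h2⟩, g, h1⟩

theorem eq_id_of_deg {a c : V} (h : a ⟶ c) (hd : Λ.deg h = 0) :
    (⟨a, h⟩ : PathInto c) = ⟨c, 𝟙 c⟩ := by
  have h0 : h ≫ 𝟙 c = 𝟙 a ≫ h := by simp
  have := Λ.factor_unique h0 (by rw [hd, Λ.deg_id])
  have h1 : c = a := congrArg (fun x => x.1) this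
  subst h1
  simp only [Sigma.mk.injEq, heq_eq_eq, Prod.mk.injEq, true_and] at this
  simp [this.1]

/-- `Λ^{≤ n}`: the paths of degree at most `n` which cannot be extended within degree `n`. -/
def Maximal (n : Fin k → ℕ) {a : V} (p : PathInto a) : Prop :=
  Λ.deg p.2 ≤ n ∧ ∀ i, Λ.deg p.2 i < n i → IsEmpty (Λ.Edge p.1 i)

theorem finite_deg [Λ.RowFinite] (a : V) (N : ℕ) :
    {p : PathInto a | ∑ i, Λ.deg p.2 i = N}.Finite := by
  induction N generalizing a with
  | zero =>
    refine (Set.finite_singleton (⟨a, 𝟙 a⟩ : PathInto a)).subset ?_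
    intro p hp
    apply Λ.eq_id_of_deg
    funext i
    simpa using (Finset.sum_eq_zero_iff.1 hp) i (Finset.mem_univ i)
  | succ N ih =>
    have : (⋃ i : Fin k, ⋃ e : Λ.Edge a i,
        e.1.extend '' {p : PathInto e.1.1 | ∑ i, Λ.deg p.2 i = N}).Finite :=
      Set.finite_iUnion fun i => Set.finite_iUnion fun e => (ih e.1.1).image _
    refine this.subset ?_
    intro p hp
    obtain ⟨i, hi⟩ : ∃ i, 0 < Λ.deg p.2 i := by
      by_contra hcon
      push Not at hcon
      have : ∑ i, Λ.deg p.2 i = 0 := Finset.sum_eq_zero fun i _ => Nat.le_zero.1 (hcon i)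
      have h1 : ∑ j, Λ.deg p.2 j = N + 1 := hp
      omega
    obtain ⟨e, g, hg⟩ := Λ.exists_edge p.2 hi
    refine Set.mem_iUnion.2 ⟨i, Set.mem_iUnion.2 ⟨e, ⟨⟨p.1, g⟩, ?_, ?_⟩⟩⟩
    · have h1 : ∑ j, Λ.deg p.2 j = N + 1 := hp
      rw [← hg, Λ.deg_comp, e.2] at h1
      simp only [Pi.add_apply, Finset.sum_add_distrib, Finset.sum_pi_single', Finset.mem_univ,
        if_true] at h1
      show ∑ j, Λ.deg g j = N
      omega
    · simp [PathInto.extend, hg]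

theorem finite_maximal [Λ.RowFinite] (a : V) (n : Fin k → ℕ) :
    {p : PathInto a | Λ.Maximal n p}.Finite := by
  have : (⋃ N ∈ Set.Iic (∑ i, n i), {p : PathInto a | ∑ i, Λ.deg p.2 i = N}).Finite :=
    (Set.finite_Iic _).biUnion fun N _ => Λ.finite_deg a N
  refine this.subset fun p hp => ?_
  simp only [Set.mem_iUnion]
  exact ⟨_, Finset.sum_le_sum fun i _ => hp.1 i, rfl⟩

/-- The finite set `aΛ^{≤ n}`. -/
def leaves [Λ.RowFinite] (a : V) (n : Fin k → ℕ) : Finset (PathInto a) :=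
  (Λ.finite_maximal a n).toFinset

theorem mem_leaves [Λ.RowFinite] {a : V} {n : Fin k → ℕ} {p : PathInto a} :
    p ∈ Λ.leaves a n ↔ Λ.Maximal n p := by simp [leaves]

theorem maximal_push {n : Fin k → ℕ} {a b : V} (f : a ⟶ b) (p : PathInto a) :
    Λ.Maximal (n + Λ.deg f) (p.push f) ↔ Λ.Maximal n p := by
  simp only [Maximal, PathInto.push, Λ.deg_comp, Pi.add_apply]
  refine and_congr ?_ (forall_congr' fun i => imp_congr ?_ Iff.rfl)
  · rw [add_comm n]; exact add_le_add_iff_left _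
  · omega

open Classical in
theorem mem_caret [Λ.RowFinite] {a : V} {i : Fin k} {p : PathInto a} :
    p ∈ Λ.caret a i ↔ Λ.deg p.2 = Pi.single i 1 ∨ (p = ⟨a, 𝟙 a⟩ ∧ IsEmpty (Λ.Edge a i)) := by
  unfold caret
  split_ifs with h
  · simp only [Finset.mem_image, Finset.mem_univ, true_and, Subtype.exists, exists_prop,
      exists_eq_right]
    constructor
    · exact Or.inl
    · rintro (h1 | ⟨-, h1⟩)
      · exact h1
      · exact absurd h (not_nonempty_iff.2 h1)
  · rw [Finset.mem_singleton]
    constructor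
    · exact fun hp => Or.inr ⟨hp, not_nonempty_iff.1 h⟩
    · rintro (h1 | ⟨h1, -⟩)
      · exact absurd ⟨⟨p, h1⟩⟩ h
      · exact h1

theorem maximal_step [Λ.RowFinite] [hc : Λ.LocallyConvex] {a : V} {n : Fin k → ℕ} (i : Fin k)
    (p : PathInto a) :
    Λ.Maximal (n + Pi.single i 1) p ↔
      ∃ q : PathInto a, Λ.Maximal n q ∧ ∃ α ∈ Λ.caret q.1 i, q.extend α = p := by
  constructor
  · intro hp
    by_cases h : Λ.deg p.2 i = n i + 1
    · have hle : Λ.deg p.2 - Pi.single i 1 ≤ Λ.deg p.2 := tsub_le_self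
      obtain ⟨b, g, f, h1, h2⟩ := Λ.exists_factor p.2 hle
      have hg : Λ.deg g = Pi.single i 1 := by
        have h3 := Λ.deg_comp g f
        rw [h1, h2] at h3
        have h4 : Pi.single i 1 ≤ Λ.deg p.2 := single_le_iff.2 (by omega)
        have h5 := tsub_add_cancel_of_le h4
        rw [← h5] at h3
        simp only [add_tsub_cancel_right] at h3
        exact (add_left_cancel h3).symm
      have hdf : ∀ j, Λ.deg f j + (Pi.single i 1 : Fin k → ℕ) j = Λ.deg p.2 j := by
        intro j; rw [← h1, Λ.deg_comp, hg]; rfl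
      refine ⟨⟨b, f⟩, ⟨?_, ?_⟩, ⟨p.1, g⟩, Λ.mem_caret.2 (Or.inl hg), by simp [PathInto.extend, h1]⟩
      · intro j
        have := hp.1 j
        have := hdf j
        simp only [Pi.add_apply] at *
        omega
      · intro j hj
        have h6 := hdf j
        by_cases hji : j = i
        · subst hji
          simp only [Pi.single_eq_same] at h6
          simp only at hj
          omega
        · simp only [Pi.single_eq_of_ne hji] at h6
          have h7 : IsEmpty (Λ.Edge p.1 j) := hp.2 j (by
            simp only [Pi.add_apply, Pi.single_eq_of_ne hji]; simp only at hj; omega)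
          by_contra hne
          exact (not_nonempty_iff.2 h7) (hc.nonempty b i j (Ne.symm hji) ⟨⟨p.1, g⟩, hg⟩
            (not_isEmpty_iff.1 hne))
    · have h0 := hp.1 i
      simp only [Pi.add_apply, Pi.single_eq_same] at h0
      refine ⟨p, ⟨?_, ?_⟩, ⟨p.1, 𝟙 p.1⟩, Λ.mem_caret.2 (Or.inr ⟨rfl, hp.2 i ?_⟩), ?_⟩
      · intro j
        have := hp.1 j
        by_cases hji : j = i
        · subst hji
          show Λ.deg p.2 j ≤ n j
          omega
        · simpa [Pi.single_eq_of_ne hji] using this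
      · intro j hj
        exact hp.2 j (by simp only [Pi.add_apply]; omega)
      · simp only [Pi.add_apply, Pi.single_eq_same]; omega
      · simp [PathInto.extend]
  · rintro ⟨q, hq, α, hα, rfl⟩
    rcases Λ.mem_caret.1 hα with h | ⟨rfl, h⟩
    · have hd : ∀ j, Λ.deg (q.extend α).2 j = Λ.deg q.2 j + (Pi.single i 1 : Fin k → ℕ) j := by
        intro j; simp only [PathInto.extend, Λ.deg_comp, h]; rfl
      refine ⟨fun j => ?_, fun j hj => ?_⟩
      · rw [hd]; exact Nat.add_le_add_right (hq.1 j) _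
      · rw [hd, Pi.add_apply] at hj
        have h1 := hq.2 j (by omega)
        by_contra hne
        obtain ⟨e⟩ := not_isEmpty_iff.1 hne
        have h2 : 0 < Λ.deg (e.1.2 ≫ α.2) j := by
          rw [Λ.deg_comp, e.2]; simp
        obtain ⟨e', -⟩ := Λ.exists_edge _ h2
        exact h1.false e'
    · have hd : Λ.deg (q.extend ⟨q.1, 𝟙 q.1⟩).2 = Λ.deg q.2 := by simp [PathInto.extend]
      refine ⟨fun j => ?_, fun j hj => ?_⟩
      · rw [hd]; exact (hq.1 j).trans (by simp)
      · rw [hd] at hj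
        by_cases hji : j = i
        · subst hji; exact h
        · exact hq.2 j (by simpa [Pi.single_eq_of_ne hji] using hj)

/-- The decomposition of a path into a leaf of `Λ^{≤ n}` and an element of a caret is unique. -/
theorem step_unique [Λ.RowFinite] {a : V} {i : Fin k} {q q' : PathInto a} {α : PathInto q.1}
    {α' : PathInto q'.1} (hα : α ∈ Λ.caret q.1 i) (hα' : α' ∈ Λ.caret q'.1 i)
    {n : Fin k → ℕ} (hq : Λ.Maximal n q) (hq' : Λ.Maximal n q')
    (h : q.extend α = q'.extend α') : (⟨q, α⟩ : Σ q : PathInto a, PathInto q.1) = ⟨q', α'⟩ := by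
  have hd : Λ.deg q.2 = Λ.deg q'.2 := by
    have hdd : Λ.deg (q.extend α).2 = Λ.deg (q'.extend α').2 := by rw [h]
    rw [Λ.deg_comp, Λ.deg_comp] at hdd
    rcases Λ.mem_caret.1 hα with h1 | ⟨h1, h2⟩ <;> rcases Λ.mem_caret.1 hα' with h3 | ⟨h3, h4⟩
    · rw [h1, h3] at hdd; exact add_right_cancel hdd
    · exfalso
      subst h3
      rw [h1, Λ.deg_id, add_zero] at hdd
      have h5 := hq'.1 i
      rw [← hdd, Pi.add_apply, Pi.single_eq_same] at h5
      exact (hq.2 i h5).false ⟨α, h1⟩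
    · exfalso
      subst h1
      rw [h3, Λ.deg_id, add_zero] at hdd
      have h5 := hq.1 i
      rw [hdd, Pi.add_apply, Pi.single_eq_same] at h5
      exact (hq'.2 i h5).false ⟨α', h3⟩
    · subst h1; subst h3
      simpa [Λ.deg_id] using hdd
  obtain ⟨b, f⟩ := q
  obtain ⟨b', f'⟩ := q'
  obtain ⟨c, g⟩ := α
  obtain ⟨c', g'⟩ := α'
  have h1 : c = c' := congrArg (fun x => x.1) h
  subst h1
  have h2 : g ≫ f = g' ≫ f' := by simpa using h
  have h3 := Λ.factor_unique h2 hd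
  have h4 : b = b' := congrArg (fun x => x.1) h3
  subst h4
  simp only [Sigma.mk.injEq, heq_eq_eq, Prod.mk.injEq, true_and] at h3
  rw [h3.1, h3.2]

/-- Nonemptiness of `aΛ^{e_i}` propagates along paths of degree zero in colour `i`. -/
theorem nonempty_edge_of_path [hc : Λ.LocallyConvex] (i : Fin k) (N : ℕ) :
    ∀ {a b : V} (f : a ⟶ b), ∑ j, Λ.deg f j = N → Λ.deg f i = 0 → Nonempty (Λ.Edge b i) →
      Nonempty (Λ.Edge a i) := by
  induction N with
  | zero =>
    intro a b f hf _ hb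
    have h0 : Λ.deg f = 0 := by
      funext j
      simpa using (Finset.sum_eq_zero_iff.1 hf) j (Finset.mem_univ j)
    have h1 : a = b := congrArg (fun x => x.1) (Λ.eq_id_of_deg f h0)
    subst h1
    exact hb
  | succ N ih =>
    intro a b f hf hi hb
    obtain ⟨j, hj⟩ : ∃ j, 0 < Λ.deg f j := by
      by_contra hcon
      push Not at hcon
      have : ∑ i, Λ.deg f i = 0 := Finset.sum_eq_zero fun i _ => Nat.le_zero.1 (hcon i)
      omega
    obtain ⟨e, g, hg⟩ := Λ.exists_edge f hj
    have hji : j ≠ i := by rintro rfl; omega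
    have hd : ∀ l, Λ.deg f l = (Pi.single j 1 : Fin k → ℕ) l + Λ.deg g l := by
      intro l; rw [← hg, Λ.deg_comp, e.2]; rfl
    refine ih g ?_ ?_ (hc.nonempty b j i hji e hb)
    · simp only [hd, Finset.sum_add_distrib] at hf
      have h2 : ∑ l, (Pi.single j 1 : Fin k → ℕ) l = 1 := by simp
      omega
    · have := hd i
      omega

end KGraph

namespace KGraph

variable {k : ℕ} {V : Type u} [Category.{v} V] (Λ : KGraph k V)

theorem sum_leaves_step [Λ.RowFinite] [Λ.LocallyConvex] {R : Type*} [AddCommMonoid R] (a : V)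
    (n : Fin k → ℕ) (i : Fin k) (F : PathInto a → R) :
    ∑ p ∈ Λ.leaves a (n + Pi.single i 1), F p =
      ∑ q ∈ Λ.leaves a n, ∑ α ∈ Λ.caret q.1 i, F (q.extend α) := by
  rw [Finset.sum_sigma']
  symm
  refine Finset.sum_bij (fun x _ => x.1.extend x.2) ?_ ?_ ?_ ?_
  · rintro ⟨q, α⟩ hx
    rw [Finset.mem_sigma] at hx
    exact Λ.mem_leaves.2 ((Λ.maximal_step i _).2 ⟨q, Λ.mem_leaves.1 hx.1, α, hx.2, rfl⟩)
  · rintro ⟨q, α⟩ hx ⟨q', α'⟩ hx' h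
    rw [Finset.mem_sigma] at hx hx'
    exact Λ.step_unique hx.2 hx'.2 (Λ.mem_leaves.1 hx.1) (Λ.mem_leaves.1 hx'.1) h
  · intro p hp
    obtain ⟨q, hq, α, hα, h⟩ := (Λ.maximal_step i p).1 (Λ.mem_leaves.1 hp)
    exact ⟨⟨q, α⟩, Finset.mem_sigma.2 ⟨Λ.mem_leaves.2 hq, hα⟩, h⟩
  · intros; rfl

theorem le_induction {P : (Fin k → ℕ) → Prop} {n : Fin k → ℕ} (h0 : P n)
    (hs : ∀ m, n ≤ m → ∀ i, P m → P (m + Pi.single i 1)) {m : Fin k → ℕ} (hm : n ≤ m) : P m := by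
  have key : ∀ (N : ℕ) (d : Fin k → ℕ), ∑ i, d i = N → P (n + d) := by
    intro N
    induction N with
    | zero =>
      intro d hd
      have : d = 0 := by
        funext i
        simpa using (Finset.sum_eq_zero_iff.1 hd) i (Finset.mem_univ i)
      rwa [this, add_zero]
    | succ N ih =>
      intro d hd
      obtain ⟨i, hi⟩ : ∃ i, 0 < d i := by
        by_contra hcon
        push Not at hcon
        have : ∑ i, d i = 0 := Finset.sum_eq_zero fun i _ => Nat.le_zero.1 (hcon i)
        omega
      obtain ⟨d', rfl⟩ : ∃ d', d = d' + Pi.single i 1 :=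
        ⟨d - Pi.single i 1, (tsub_add_cancel_of_le (single_le_iff.2 hi)).symm⟩
      rw [← add_assoc]
      refine hs _ le_self_add i (ih d' ?_)
      simpa [Finset.sum_add_distrib] using hd
  have := key _ (m - n) rfl
  rwa [add_tsub_cancel_of_le hm] at this

end KGraph

namespace ALMod

open scoped Classical

variable {k : ℕ} {V : Type u} [Category.{v} V] {Λ : KGraph k V} [Λ.RowFinite]
variable (M : ALMod.{v, u, w} Λ)

theorem A_id_comp {a b : V} (f : a ⟶ b) (ξ : M.H) : M.A (𝟙 a) (M.A f ξ) = M.A f ξ := by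
  have := congrArg (fun T : M.H →L[ℂ] M.H => T ξ) (M.map_comp (𝟙 a) f)
  simpa using this.symm

theorem A_mem_fiber {a b : V} (f : a ⟶ b) (ξ : M.H) : M.A f ξ ∈ M.fiber a :=
  ⟨M.A f ξ, M.A_id_comp f ξ⟩

theorem A_id_of_mem {a : V} {ξ : M.H} (h : ξ ∈ M.fiber a) : M.A (𝟙 a) ξ = ξ := by
  obtain ⟨η, rfl⟩ := h
  exact M.A_id_comp _ _

/-- The caret maps `H_a → ⨁ H_{s(α)}` are isometric. -/
theorem sum_caret {a : V} (i : Fin k) {ξ η : M.H} (hη : η ∈ M.fiber a) :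
    ∑ α ∈ Λ.caret a i, inner ℂ (M.A α.2 η) (M.A α.2 ξ) = inner ℂ η ξ := by
  unfold KGraph.caret
  split_ifs with h
  · rw [Finset.sum_image (fun x _ y _ h => Subtype.ext h)]
    have := congrArg (fun T : M.H →L[ℂ] M.H => inner ℂ (T η) ξ) (M.sum_adjoint_comp a i h)
    simp only [sum_apply, sum_inner, ContinuousLinearMap.comp_apply, adjoint_inner_left,
      M.A_id_of_mem hη] at this
    exact this
  · rw [Finset.sum_singleton]
    have h1 := isSelfAdjoint_iff_isSymmetric.1 (M.isStarProjection a).isSelfAdjoint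
    rw [M.A_id_of_mem hη]
    have := h1 η ξ
    simp only [ContinuousLinearMap.coe_coe, M.A_id_of_mem hη] at this
    exact this.symm

/-- `A_ν` if `τ = p ∘ ν` (such a `ν` is unique), and `0` if `τ` does not extend `p`. -/
def cut {a : V} (p τ : PathInto a) : M.H →L[ℂ] M.H :=
  if h : ∃ ν : τ.1 ⟶ p.1, ν ≫ p.2 = τ.2 then M.A h.choose else 0

theorem cut_of_eq {a : V} {p τ : PathInto a} (ν : τ.1 ⟶ p.1) (h : ν ≫ p.2 = τ.2) :
    M.cut p τ = M.A ν := by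
  have hex : ∃ ν : τ.1 ⟶ p.1, ν ≫ p.2 = τ.2 := ⟨ν, h⟩
  unfold cut
  rw [dif_pos hex, Λ.cancel (hex.choose_spec.trans h.symm)]

theorem cut_of_not {a : V} {p τ : PathInto a} (h : ¬ ∃ ν : τ.1 ⟶ p.1, ν ≫ p.2 = τ.2) :
    M.cut p τ = 0 := dif_neg h

theorem cut_extend {a : V} {p σ : PathInto a} {n : Fin k → ℕ} (hp : Λ.deg p.2 ≤ n)
    (hσ : Λ.Maximal n σ) (α : PathInto σ.1) : M.cut p (σ.extend α) = M.A α.2 ∘L M.cut p σ := by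
  by_cases h : ∃ ν : σ.1 ⟶ p.1, ν ≫ p.2 = σ.2
  · obtain ⟨ν, hν⟩ := h
    rw [M.cut_of_eq ν hν, M.cut_of_eq (p := p) (τ := σ.extend α) (α.2 ≫ ν)
      (by simp [hν]), M.map_comp]
  · rw [M.cut_of_not h, M.cut_of_not, comp_zero]
    rintro ⟨ν, hν⟩
    by_cases hle : Λ.deg p.2 ≤ Λ.deg σ.2
    · obtain ⟨b, g, f, h1, h2⟩ := Λ.exists_factor σ.2 hle
      have h3 : ν ≫ p.2 = (α.2 ≫ g) ≫ f := by rw [hν, Category.assoc, h1]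
      have h4 := Λ.factor_unique h3 h2.symm
      obtain ⟨c, q⟩ := p
      have h5 : c = b := congrArg (fun x => x.1) h4
      subst h5
      simp only [Sigma.mk.injEq, heq_eq_eq, Prod.mk.injEq, true_and] at h4
      exact h ⟨g, by rw [← h1, h4.2]⟩
    · rw [Pi.le_def] at hle
      push Not at hle
      obtain ⟨j, hj⟩ := hle
      have h1 := hσ.2 j (lt_of_lt_of_le hj (hp j))
      have h2 := congrArg (fun x => Λ.deg x j) hν
      simp only [PathInto.extend, Λ.deg_comp, Pi.add_apply] at h2
      obtain ⟨e, -⟩ := Λ.exists_edge (i := j) α.2 (by omega)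
      exact h1.false e

theorem cut_mem_fiber {a : V} (p τ : PathInto a) (ξ : M.H) : M.cut p τ ξ ∈ M.fiber τ.1 := by
  unfold cut
  split_ifs with h
  · exact M.A_mem_fiber _ _
  · simp

/-- The vector space of formal sums of pairs `(λ, ξ)` with `λ` a path with range `a` and
`ξ ∈ H_{s(λ)}`, bilinear in the second entry. -/
def Pre (a : V) : Type (max u v w) := Π₀ p : PathInto a, M.fiber p.1

instance (a : V) : AddCommGroup (M.Pre a) :=
  inferInstanceAs (AddCommGroup (Π₀ p : PathInto a, M.fiber p.1))

instance (a : V) : Module ℂ (M.Pre a) :=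
  inferInstanceAs (Module ℂ (Π₀ p : PathInto a, M.fiber p.1))

/-- The formal pair `(λ, ξ)`. -/
def pair {a : V} (p : PathInto a) : M.fiber p.1 →ₗ[ℂ] M.Pre a :=
  DFinsupp.lsingle (R := ℂ) (M := fun p : PathInto a => M.fiber p.1) p

theorem pre_hom_ext {a : V} {E : Type*} [AddCommGroup E] [Module ℂ E] {φ ψ : M.Pre a →ₗ[ℂ] E}
    (h : ∀ p ξ, φ (M.pair p ξ) = ψ (M.pair p ξ)) : φ = ψ :=
  DFinsupp.lhom_ext h

theorem pre_induction {a : V} {P : M.Pre a → Prop}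
    (h0 : P 0) (hadd : ∀ x y, P x → P y → P (x + y))
    (hp : ∀ p ξ, P (M.pair p ξ)) (x : M.Pre a) : P x :=
  DFinsupp.induction x h0 fun i b _ _ _ hf => hadd _ _ (hp i b) hf

/-- A linear map on formal sums, from its values on pairs. -/
def preLift {a : V} {E : Type*} [AddCommGroup E] [Module ℂ E]
    (F : ∀ p : PathInto a, M.fiber p.1 →ₗ[ℂ] E) : M.Pre a →ₗ[ℂ] E := DFinsupp.lsum ℂ F

theorem preLift_pair {a : V} {E : Type*} [AddCommGroup E] [Module ℂ E]
    (F : ∀ p : PathInto a, M.fiber p.1 →ₗ[ℂ] E) (p : PathInto a) (ξ : M.fiber p.1) :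
    M.preLift F (M.pair p ξ) = F p ξ := DFinsupp.lsum_single ℂ F p ξ

/-- The linear map with `(λ, ξ) ↦ A_ν ξ` if `τ = λ ∘ ν`, and `(λ, ξ) ↦ 0` otherwise. -/
def coord {a : V} (τ : PathInto a) : M.Pre a →ₗ[ℂ] M.H :=
  M.preLift fun p => (M.cut p τ).toLinearMap ∘ₗ (M.fiber p.1).subtype

theorem coord_pair {a : V} (τ p : PathInto a) (ξ : M.fiber p.1) :
    M.coord τ (M.pair p ξ) = M.cut p τ ξ := M.preLift_pair _ _ _

theorem coord_mem_fiber {a : V} (τ : PathInto a) (x : M.Pre a) : M.coord τ x ∈ M.fiber τ.1 := by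
  refine M.pre_induction (P := fun x => M.coord τ x ∈ M.fiber τ.1) (by simp) (fun x y hx hy => ?_) (fun p ξ => ?_) x
  · rw [map_add]; exact add_mem hx hy
  · rw [coord_pair]; exact M.cut_mem_fiber _ _ _

/-- The join of the degrees of the paths that occur in a formal sum. -/
def degBound {a : V} (x : M.Pre a) : Fin k → ℕ :=
  (DFinsupp.support (show Π₀ p : PathInto a, M.fiber p.1 from x)).sup fun p => Λ.deg p.2

theorem coord_extend {a : V} {x : M.Pre a} {n : Fin k → ℕ} (hx : M.degBound x ≤ n)
    {σ : PathInto a} (hσ : Λ.Maximal n σ) (α : PathInto σ.1) :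
    M.coord (σ.extend α) x = M.A α.2 (M.coord σ x) := by
  have hx' := Finset.sup_le_iff.1 hx
  have hsum : x = ∑ p ∈ DFinsupp.support (show Π₀ p : PathInto a, M.fiber p.1 from x),
      M.pair p ((show Π₀ p : PathInto a, M.fiber p.1 from x) p) :=
    (DFinsupp.sum_single (f := show Π₀ p : PathInto a, M.fiber p.1 from x)).symm
  rw [hsum]
  simp only [map_sum, coord_pair]
  refine Finset.sum_congr rfl fun p hp => ?_
  rw [M.cut_extend (hx' p hp) hσ]; rfl

/-- `∑_{τ ∈ aΛ^{≤ n}} ⟨x_τ, y_τ⟩`, where for `x = (λ, ξ)` one has `x_τ = A_ν ξ` if `τ = λ ∘ ν`. -/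
def form {a : V} (n : Fin k → ℕ) (x y : M.Pre a) : ℂ :=
  ∑ τ ∈ Λ.leaves a n, inner ℂ (M.coord τ x) (M.coord τ y)

/-- The sesquilinear form of the construction: on pairs it is
`[(λ, ξ) | (μ, η)] = ∑ ⟨A_ν ξ, A_γ η⟩`, the sum over `λ ∘ ν = μ ∘ γ ∈ Λ^{≤ d(λ) + d(μ)}`. -/
def ip {a : V} (x y : M.Pre a) : ℂ := M.form (M.degBound x + M.degBound y) x y

variable [Λ.LocallyConvex]

theorem form_eq_of_le {a : V} {x y : M.Pre a} {n m : Fin k → ℕ} (hx : M.degBound x ≤ n)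
    (hy : M.degBound y ≤ n) (hnm : n ≤ m) : M.form m x y = M.form n x y := by
  refine KGraph.le_induction (P := fun m => M.form m x y = M.form n x y) rfl ?_ hnm
  intro m hm i ih
  rw [← ih]
  unfold form
  rw [Λ.sum_leaves_step]
  refine Finset.sum_congr rfl fun q hq => ?_
  rw [← M.sum_caret i (M.coord_mem_fiber q x)]
  refine Finset.sum_congr rfl fun α _ => ?_
  rw [M.coord_extend (hx.trans hm) (Λ.mem_leaves.1 hq),
    M.coord_extend (hy.trans hm) (Λ.mem_leaves.1 hq)]

theorem ip_eq {a : V} {x y : M.Pre a} {n : Fin k → ℕ} (hx : M.degBound x ≤ n)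
    (hy : M.degBound y ≤ n) : M.ip x y = M.form n x y := by
  have h1 : M.degBound x ≤ M.degBound x + M.degBound y := le_self_add
  have h2 : M.degBound y ≤ M.degBound x + M.degBound y := le_add_self
  unfold ip
  rw [← M.form_eq_of_le h1 h2 (m := M.degBound x + M.degBound y + n) le_self_add,
    ← M.form_eq_of_le hx hy (m := M.degBound x + M.degBound y + n) le_add_self]

/-- The form is positive semidefinite. -/
@[reducible]
def preCore (a : V) : PreInnerProductSpace.Core ℂ (M.Pre a) where
  inner := M.ip
  conj_inner_symm x y := by
    have hx : M.degBound x ≤ M.degBound x + M.degBound y := le_self_add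
    have hy : M.degBound y ≤ M.degBound x + M.degBound y := le_add_self
    show starRingEnd ℂ (M.ip y x) = M.ip x y
    rw [M.ip_eq hx hy, M.ip_eq hy hx]
    simp [form]
  re_inner_nonneg x := by
    show 0 ≤ RCLike.re (M.ip x x)
    rw [M.ip_eq le_rfl le_rfl]
    simp only [form, map_sum]
    exact Finset.sum_nonneg fun τ _ => inner_self_nonneg
  add_left x y z := by
    show M.ip (x + y) z = M.ip x z + M.ip y z
    obtain ⟨n, h1, h2, h3, h4⟩ : ∃ n, M.degBound x ≤ n ∧ M.degBound y ≤ n ∧ M.degBound z ≤ n ∧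
        M.degBound (x + y) ≤ n :=
      ⟨M.degBound x + M.degBound y + M.degBound z + M.degBound (x + y),
        fun i => by simp only [Pi.add_apply]; omega, fun i => by simp only [Pi.add_apply]; omega,
        fun i => by simp only [Pi.add_apply]; omega, fun i => by simp only [Pi.add_apply]; omega⟩
    rw [M.ip_eq h4 h3, M.ip_eq h1 h3, M.ip_eq h2 h3]
    simp only [form, map_add, inner_add_left, Finset.sum_add_distrib]
  smul_left x y c := by
    show M.ip (c • x) y = starRingEnd ℂ c * M.ip x y
    obtain ⟨n, h1, h2, h3⟩ : ∃ n, M.degBound x ≤ n ∧ M.degBound y ≤ n ∧ M.degBound (c • x) ≤ n :=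
      ⟨M.degBound x + M.degBound y + M.degBound (c • x),
        fun i => by simp only [Pi.add_apply]; omega, fun i => by simp only [Pi.add_apply]; omega,
        fun i => by simp only [Pi.add_apply]; omega⟩
    rw [M.ip_eq h3 h2, M.ip_eq h1 h2]
    simp only [form, map_smul, inner_smul_left, Finset.mul_sum]

instance (a : V) : SeminormedAddCommGroup (M.Pre a) :=
  @InnerProductSpace.Core.toSeminormedAddCommGroup ℂ _ _ _ _ (M.preCore a)

instance (a : V) : InnerProductSpace ℂ (M.Pre a) := InnerProductSpace.ofCore (M.preCore a)

theorem inner_eq_ip {a : V} (x y : M.Pre a) : inner ℂ x y = M.ip x y := rfl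

end ALMod

namespace ALMod

open scoped Classical
open UniformSpace

variable {k : ℕ} {V : Type u} [Category.{v} V] {Λ : KGraph k V} [Λ.RowFinite]
variable (M : ALMod.{v, u, w} Λ)

/-- `(λ, ξ) ↦ (f ∘ λ, ξ)`. -/
def shift {a b : V} (f : a ⟶ b) : M.Pre a →ₗ[ℂ] M.Pre b :=
  M.preLift fun p => M.pair (p.push f)

theorem shift_pair {a b : V} (f : a ⟶ b) (p : PathInto a) (ξ : M.fiber p.1) :
    M.shift f (M.pair p ξ) = M.pair (p.push f) ξ := M.preLift_pair _ _ _

theorem pair_congr {a c : V} {f g : c ⟶ a} (h : f = g) (ξ : M.fiber c) :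
    M.pair ⟨c, f⟩ ξ = M.pair ⟨c, g⟩ ξ := by subst h; rfl

theorem shift_id (a : V) (x : M.Pre a) : M.shift (𝟙 a) x = x := by
  have : M.shift (𝟙 a) = LinearMap.id := by
    refine M.pre_hom_ext fun p ξ => ?_
    rw [shift_pair]
    obtain ⟨c, p⟩ := p
    exact M.pair_congr (Category.comp_id p) ξ
  rw [this]; rfl

theorem shift_comp {a b c : V} (g : a ⟶ b) (f : b ⟶ c) (x : M.Pre a) :
    M.shift f (M.shift g x) = M.shift (g ≫ f) x := by
  have : M.shift f ∘ₗ M.shift g = M.shift (g ≫ f) := by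
    refine M.pre_hom_ext fun p ξ => ?_
    rw [LinearMap.comp_apply, shift_pair, shift_pair, shift_pair]
    obtain ⟨d, p⟩ := p
    exact M.pair_congr (Category.assoc p g f) ξ
  rw [← this]; rfl

theorem coord_push {a b : V} (f : a ⟶ b) (τ : PathInto a) (x : M.Pre a) :
    M.coord (τ.push f) (M.shift f x) = M.coord τ x := by
  have : M.coord (τ.push f) ∘ₗ M.shift f = M.coord τ := by
    refine M.pre_hom_ext fun p ξ => ?_
    rw [LinearMap.comp_apply, shift_pair, coord_pair, coord_pair]
    by_cases h : ∃ ν : τ.1 ⟶ p.1, ν ≫ p.2 = τ.2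
    · obtain ⟨ν, hν⟩ := h
      rw [M.cut_of_eq ν hν, M.cut_of_eq (p := p.push f) (τ := τ.push f) ν (by
        simp only [PathInto.push]; rw [← Category.assoc, hν])]
    · rw [M.cut_of_not h, M.cut_of_not]
      rintro ⟨ν, hν⟩
      simp only [PathInto.push] at hν
      rw [← Category.assoc] at hν
      exact h ⟨ν, Λ.cancel hν⟩
  rw [← this]; rfl

theorem coord_shift_of_not {a b : V} (f : a ⟶ b) (τ : PathInto b)
    (h : ¬ ∃ σ : PathInto a, σ.push f = τ) (x : M.Pre a) : M.coord τ (M.shift f x) = 0 := by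
  have : M.coord τ ∘ₗ M.shift f = 0 := by
    refine M.pre_hom_ext fun p ξ => ?_
    rw [LinearMap.comp_apply, shift_pair, coord_pair, M.cut_of_not]
    · simp
    · rintro ⟨ν, hν⟩
      exact h ⟨⟨τ.1, ν ≫ p.2⟩, by simp only [PathInto.push] at hν ⊢; simp [hν]⟩
  exact congrArg (fun T => T x) this

/-- Vectors `[e ∘ λ, ξ]` and `[e' ∘ μ, η]` are orthogonal if `e ≠ e'` have the same colour. -/
theorem ip_shift_of_ne {b : V} {i : Fin k} (e e' : Λ.Edge b i) (h : e ≠ e') (x : M.Pre e.1.1)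
    (y : M.Pre e'.1.1) : M.ip (M.shift e.1.2 x) (M.shift e'.1.2 y) = 0 := by
  refine Finset.sum_eq_zero fun τ _ => ?_
  by_cases h1 : ∃ σ : PathInto e.1.1, σ.push e.1.2 = τ
  · by_cases h2 : ∃ σ : PathInto e'.1.1, σ.push e'.1.2 = τ
    · exfalso
      obtain ⟨⟨c, g⟩, rfl⟩ := h1
      obtain ⟨⟨c', g'⟩, h3⟩ := h2
      have h4 : c' = c := congrArg (fun x => x.1) h3
      subst h4
      have h5 : g' ≫ e'.1.2 = g ≫ e.1.2 := by simpa [PathInto.push] using h3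
      have h6 := Λ.factor_unique h5 (by rw [e.2, e'.2])
      apply h
      obtain ⟨⟨d, e⟩, he⟩ := e
      obtain ⟨⟨d', e'⟩, he'⟩ := e'
      have h7 : d' = d := congrArg (fun x => x.1) h6
      subst h7
      simp only [Sigma.mk.injEq, heq_eq_eq, Prod.mk.injEq, true_and] at h6
      simp [h6.2]
    · rw [M.coord_shift_of_not _ _ h2, inner_zero_right]
  · rw [M.coord_shift_of_not _ _ h1, inner_zero_left]

variable [Λ.LocallyConvex]

theorem ip_shift {a b : V} (f : a ⟶ b) (x y : M.Pre a) :
    M.ip (M.shift f x) (M.shift f y) = M.ip x y := by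
  obtain ⟨n, h1, h2, h3, h4⟩ : ∃ n, M.degBound x ≤ n ∧ M.degBound y ≤ n ∧
      M.degBound (M.shift f x) ≤ n ∧ M.degBound (M.shift f y) ≤ n :=
    ⟨M.degBound x + M.degBound y + M.degBound (M.shift f x) + M.degBound (M.shift f y),
      fun i => by simp only [Pi.add_apply]; omega, fun i => by simp only [Pi.add_apply]; omega,
      fun i => by simp only [Pi.add_apply]; omega, fun i => by simp only [Pi.add_apply]; omega⟩
  rw [M.ip_eq h1 h2, M.ip_eq (h3.trans (le_self_add (b := Λ.deg f)))
    (h4.trans (le_self_add (b := Λ.deg f)))]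
  unfold form
  have hinj : Function.Injective (PathInto.push f) := by
    rintro ⟨c, g⟩ ⟨c', g'⟩ h
    have h1 : c = c' := congrArg (fun x => x.1) h
    subst h1
    have h2 : g ≫ f = g' ≫ f := by simpa [PathInto.push] using h
    rw [Λ.cancel h2]
  have : ∑ τ ∈ Λ.leaves b (n + Λ.deg f), inner ℂ (M.coord τ (M.shift f x))
      (M.coord τ (M.shift f y)) = ∑ τ ∈ (Λ.leaves a n).image (PathInto.push f),
      inner ℂ (M.coord τ (M.shift f x)) (M.coord τ (M.shift f y)) := by
    symm
    refine Finset.sum_subset ?_ ?_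
    · intro τ hτ
      obtain ⟨σ, hσ, rfl⟩ := Finset.mem_image.1 hτ
      exact Λ.mem_leaves.2 ((Λ.maximal_push f σ).2 (Λ.mem_leaves.1 hσ))
    · intro τ hτ hn
      rw [M.coord_shift_of_not f τ, inner_zero_left]
      rintro ⟨σ, rfl⟩
      exact hn (Finset.mem_image_of_mem _
        (Λ.mem_leaves.2 ((Λ.maximal_push f σ).1 (Λ.mem_leaves.1 hτ))))
  rw [this, Finset.sum_image fun x _ y _ h => hinj h]
  simp only [coord_push]

/-- The caret relation `[p, ξ] = ∑_α [p ∘ α, A_α ξ]`, as vanishing of the seminorm. -/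
theorem norm_caret {a : V} (p : PathInto a) (ξ : M.fiber p.1) (i : Fin k)
    (hi : Nonempty (Λ.Edge p.1 i)) :
    ‖M.pair p ξ - ∑ α : Λ.Edge p.1 i, M.pair (p.extend α.1) ⟨M.A α.1.2 ξ, M.A_mem_fiber _ _⟩‖
      = 0 := by
  set z := M.pair p ξ - ∑ α : Λ.Edge p.1 i, M.pair (p.extend α.1)
    ⟨M.A α.1.2 ξ, M.A_mem_fiber _ _⟩ with hz
  have hcoord : ∀ τ : PathInto a, M.coord τ z = M.cut p τ ξ -
      ∑ α : Λ.Edge p.1 i, M.cut (p.extend α.1) τ (M.A α.1.2 ξ) := by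
    intro τ
    rw [hz, map_sub, map_sum, coord_pair]
    simp only [coord_pair]
  have key : ∀ τ ∈ Λ.leaves a (M.degBound z + (Λ.deg p.2 + Pi.single i 1)), M.coord τ z = 0 := by
    intro τ hτ
    have hτ' := Λ.mem_leaves.1 hτ
    rw [hcoord]
    by_cases h : ∃ ν : τ.1 ⟶ p.1, ν ≫ p.2 = τ.2
    · obtain ⟨ν, hν⟩ := h
      have hpos : 0 < Λ.deg ν i := by
        by_contra hcon
        have h0 : Λ.deg ν i = 0 := by omega
        have h1 := Λ.nonempty_edge_of_path i _ ν rfl h0 hi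
        refine (not_nonempty_iff.2 (hτ'.2 i ?_)) h1
        rw [← hν, Λ.deg_comp]
        simp only [Pi.add_apply, Pi.single_eq_same]
        omega
      obtain ⟨e, g, hg⟩ := Λ.exists_edge ν hpos
      rw [Finset.sum_eq_single e]
      · rw [M.cut_of_eq ν hν, M.cut_of_eq (p := p.extend e.1) (τ := τ) g (by
          simp only [PathInto.extend]; rw [← Category.assoc, hg, hν]), ← hg, M.map_comp]
        simp
      · intro e' _ hne
        rw [M.cut_of_not, zero_apply]
        rintro ⟨g', hg'⟩
        apply hne
        have h2 : g' ≫ e'.1.2 = g ≫ e.1.2 := by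
          apply Λ.cancel (f := p.2)
          rw [hg, hν, ← hg', Category.assoc]
        have h3 := Λ.factor_unique h2 (by rw [e.2, e'.2])
        obtain ⟨⟨d, e⟩, he⟩ := e
        obtain ⟨⟨d', e'⟩, he'⟩ := e'
        have h4 : d' = d := congrArg (fun x => x.1) h3
        subst h4
        simp only [Sigma.mk.injEq, heq_eq_eq, Prod.mk.injEq, true_and] at h3
        simp [h3.2]
      · simp
    · rw [M.cut_of_not h, Finset.sum_eq_zero, zero_apply, sub_zero]
      intro α _
      rw [M.cut_of_not, zero_apply]
      rintro ⟨g, hg⟩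
      exact h ⟨g ≫ α.1.2, by rw [Category.assoc]; exact hg⟩
  have h0 : inner ℂ z z = 0 := by
    rw [inner_eq_ip, M.ip_eq (n := M.degBound z + (Λ.deg p.2 + Pi.single i 1)) le_self_add
      le_self_add]
    exact Finset.sum_eq_zero fun τ hτ => by rw [key τ hτ, inner_zero_left]
  have h1 := inner_self_eq_norm_sq (𝕜 := ℂ) z
  rw [h0] at h1
  simpa using h1.symm

/-- The Hilbert space `L_a`: the (separated) completion of the formal sums, closed span of the
classes `[λ, ξ]` with `λ` a path with range `a`. -/
abbrev LSpace (a : V) : Type (max u v w) := Completion (M.Pre a)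

/-- The map `(λ, ξ) ↦ (f ∘ λ, ξ)` preserves the form. -/
def shiftₗᵢ {a b : V} (f : a ⟶ b) : M.Pre a →ₗᵢ[ℂ] M.Pre b :=
  (M.shift f).isometryOfInner fun x y => M.ip_shift f x y

/-- The isometry `[λ, ξ] ↦ [f ∘ λ, ξ]` from `L_a` to `L_b`. -/
def LMap {a b : V} (f : a ⟶ b) : M.LSpace a →L[ℂ] M.LSpace b :=
  (M.shiftₗᵢ f).toContinuousLinearMap.completion

theorem LMap_coe {a b : V} (f : a ⟶ b) (x : M.Pre a) :
    M.LMap f (x : M.LSpace a) = (M.shift f x : M.Pre b) :=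
  ContinuousLinearMap.completion_apply_coe _ _

theorem LMap_id (a : V) : M.LMap (𝟙 a) = ContinuousLinearMap.id ℂ _ := by
  ext x
  refine Completion.induction_on x (isClosed_eq (by fun_prop) (by fun_prop)) fun x => ?_
  rw [LMap_coe, shift_id]; rfl

theorem LMap_comp {a b c : V} (g : a ⟶ b) (f : b ⟶ c) : M.LMap f ∘L M.LMap g = M.LMap (g ≫ f) := by
  ext x
  refine Completion.induction_on x (isClosed_eq (by fun_prop) (by fun_prop)) fun x => ?_
  rw [ContinuousLinearMap.comp_apply, LMap_coe, LMap_coe, LMap_coe, shift_comp]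

theorem inner_LMap {a b : V} (f : a ⟶ b) (x y : M.LSpace a) :
    inner ℂ (M.LMap f x) (M.LMap f y) = inner ℂ x y := by
  refine Completion.induction_on₂ x y (isClosed_eq (by fun_prop) (by fun_prop)) fun x y => ?_
  rw [LMap_coe, LMap_coe, Completion.inner_coe, Completion.inner_coe]
  exact M.ip_shift f x y

theorem adjoint_LMap_comp {a b : V} (f : a ⟶ b) :
    adjoint (M.LMap f) ∘L M.LMap f = ContinuousLinearMap.id ℂ _ := by
  ext1 x
  refine ext_inner_right ℂ fun y => ?_
  rw [ContinuousLinearMap.comp_apply, adjoint_inner_left, inner_LMap]; rfl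

theorem adjoint_LMap_of_ne {b : V} {i : Fin k} (e e' : Λ.Edge b i) (h : e ≠ e') :
    adjoint (M.LMap e.1.2) ∘L M.LMap e'.1.2 = 0 := by
  ext1 x
  refine ext_inner_right ℂ fun y => ?_
  rw [ContinuousLinearMap.comp_apply, adjoint_inner_left]
  simp only [zero_apply, inner_zero_left]
  refine Completion.induction_on₂ x y (isClosed_eq (by fun_prop) (by fun_prop)) fun x y => ?_
  rw [LMap_coe, LMap_coe, Completion.inner_coe]
  exact M.ip_shift_of_ne _ _ h.symm _ _

theorem sum_LMap (b : V) (i : Fin k) (hb : Nonempty (Λ.Edge b i)) :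
    ∑ e : Λ.Edge b i, M.LMap e.1.2 ∘L adjoint (M.LMap e.1.2) = ContinuousLinearMap.id ℂ _ := by
  set T := ∑ e : Λ.Edge b i, M.LMap e.1.2 ∘L adjoint (M.LMap e.1.2) with hT
  have h1 : ∀ (e : Λ.Edge b i) (y : M.LSpace e.1.1), T (M.LMap e.1.2 y) = M.LMap e.1.2 y := by
    intro e y
    rw [hT, sum_apply, Finset.sum_eq_single e]
    · have := congrArg (fun S : M.LSpace e.1.1 →L[ℂ] M.LSpace e.1.1 => S y)
        (M.adjoint_LMap_comp e.1.2)
      simp only [ContinuousLinearMap.comp_apply] at this ⊢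
      rw [this]; rfl
    · intro e' _ hne
      have := congrArg (fun S : M.LSpace e.1.1 →L[ℂ] M.LSpace e'.1.1 => S y)
        (M.adjoint_LMap_of_ne e' e hne)
      simp only [ContinuousLinearMap.comp_apply] at this ⊢
      rw [this]; simp
    · simp
  have h2 : ∀ (p : PathInto b) (ξ : M.fiber p.1), 0 < Λ.deg p.2 i →
      T (M.pair p ξ : M.Pre b) = (M.pair p ξ : M.Pre b) := by
    rintro ⟨c, f⟩ ξ hp
    obtain ⟨e, g, rfl⟩ := Λ.exists_edge f hp
    have := h1 e ((M.pair ⟨c, g⟩ ξ : M.Pre e.1.1) : M.LSpace e.1.1)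
    rw [LMap_coe, shift_pair] at this
    exact this
  ext x
  refine Completion.induction_on x (isClosed_eq (by fun_prop) (by fun_prop)) fun x => ?_
  rw [ContinuousLinearMap.id_apply]
  refine M.pre_induction (P := fun x => T (x : M.LSpace b) = x)
    (by rw [Completion.coe_zero, map_zero]) (fun x y hx hy => ?_)
    (fun p ξ => ?_) x
  · rw [Completion.coe_add, map_add, hx, hy]
  · rcases Nat.eq_zero_or_pos (Λ.deg p.2 i) with h0 | h0
    · have hne : Nonempty (Λ.Edge p.1 i) := Λ.nonempty_edge_of_path i _ p.2 rfl h0 hb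
      have hc : ((M.pair p ξ : M.Pre b) : M.LSpace b) = ∑ α : Λ.Edge p.1 i,
          ((M.pair (p.extend α.1) ⟨M.A α.1.2 ξ, M.A_mem_fiber _ _⟩ : M.Pre b) : M.LSpace b) := by
        rw [← sub_eq_zero, ← norm_eq_zero]
        have h3 := M.norm_caret p ξ i hne
        rw [← Completion.norm_coe, Completion.coe_sub] at h3
        rw [← h3]
        congr 2
        exact (map_sum (Completion.toComplL (𝕜 := ℂ) (E := M.Pre b)) _ _).symm
      rw [hc, map_sum]
      refine Finset.sum_congr rfl fun α _ => h2 _ _ ?_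
      simp only [PathInto.extend, Λ.deg_comp, α.2, Pi.add_apply, Pi.single_eq_same]
      omega
    · exact h2 p ξ h0

/-- The Hilbert space `L = ⨁_a L_a` of the lifted representation. -/
abbrev Lift : Type (max u v w) := lp (fun a : V => M.LSpace a) 2

/-- The inclusion `L_a → L`; its adjoint is the projection onto `L_a`. -/
def incl (a : V) : M.LSpace a →L[ℂ] M.Lift :=
  (⟨lp.lsingle 2 a, fun x => lp.norm_single (by norm_num) a x⟩ :
    M.LSpace a →ₗᵢ[ℂ] M.Lift).toContinuousLinearMap

theorem adjoint_incl (a : V) : adjoint (M.incl a) = lp.evalCLM ℂ _ 2 a := by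
  symm
  rw [eq_adjoint_iff]
  intro x y
  exact (lp.inner_single_right a y x).symm

theorem proj_incl_self (a : V) (x : M.LSpace a) : adjoint (M.incl a) (M.incl a x) = x := by
  rw [adjoint_incl]
  exact lp.single_apply_self 2 a x

theorem proj_incl_of_ne {a b : V} (h : a ≠ b) (x : M.LSpace b) :
    adjoint (M.incl a) (M.incl b x) = 0 := by
  rw [adjoint_incl]
  exact lp.single_apply_ne 2 b x h

/-- The operator `X_f`, for `f` a path from `a` to `b`: `[λ, ξ] ↦ [f ∘ λ, ξ]` on `L_a`, and `0` on
the orthogonal complement of `L_a`. -/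
def liftX {a b : V} (f : a ⟶ b) : M.Lift →L[ℂ] M.Lift :=
  M.incl b ∘L M.LMap f ∘L adjoint (M.incl a)

theorem liftX_id (a : V) : M.liftX (𝟙 a) = M.incl a ∘L adjoint (M.incl a) := by
  rw [liftX, LMap_id, ContinuousLinearMap.id_comp]

theorem adjoint_liftX {a b : V} (f : a ⟶ b) :
    adjoint (M.liftX f) = M.incl a ∘L adjoint (M.LMap f) ∘L adjoint (M.incl b) := by
  rw [liftX, adjoint_comp, adjoint_comp, adjoint_adjoint, ContinuousLinearMap.comp_assoc]

/-- The object map `Π : Mod(A_Λ) → Rep(O_Λ)` of the Pythagorean functor. -/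
def PiRep : OLRep.{v, u, max u v w} Λ where
  L := M.Lift
  X := fun f => M.liftX f
  isStarProjection := fun a => by
    refine ⟨?_, ?_⟩
    · rw [liftX_id]
      ext1 x
      simp [proj_incl_self]
    · rw [liftX_id]
      show adjoint _ = _
      rw [adjoint_comp, adjoint_adjoint]
  orthogonal := fun a b hab => by
    rw [liftX_id, liftX_id]
    ext1 x
    simp [proj_incl_of_ne M hab]
  adjoint_comp_self := fun {a b} f => by
    rw [adjoint_liftX, liftX_id]
    ext1 x
    have := congrArg (fun S : M.LSpace a →L[ℂ] M.LSpace a => S (adjoint (M.incl a) x))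
        (M.adjoint_LMap_comp f)
    simp only [ContinuousLinearMap.comp_apply, liftX, proj_incl_self] at this ⊢
    rw [this]; rfl
  sum_comp_adjoint := fun a i hi => by
    rw [liftX_id]
    ext1 x
    have := congrArg (fun S : M.LSpace a →L[ℂ] M.LSpace a => M.incl a (S (adjoint (M.incl a) x)))
        (M.sum_LMap a i hi)
    simp only [adjoint_liftX]
    simp only [ContinuousLinearMap.comp_apply, liftX, proj_incl_self, sum_apply,
      map_sum] at this ⊢
    rw [this]; rfl
  map_comp := fun g f => by
    ext1 x
    rw [liftX, liftX, liftX, ← LMap_comp]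
    simp only [ContinuousLinearMap.comp_apply, proj_incl_self]
  nondegenerate := fun ξ => by
    simp only [liftX_id, adjoint_incl]
    exact lp.hasSum_single (by norm_num) ξ

end ALMod

namespace OLRep

variable {k : ℕ} {V : Type u} [Category.{v} V] {Λ : KGraph k V} [Λ.RowFinite]

/-- `ρ` has finite Pythagorean dimension: `ρ ≅ Π(K)` for some finite dimensional module `K`. -/
def FinitePDim [Λ.LocallyConvex] (ρ : OLRep.{v, u, w} Λ) : Prop :=
  ∃ K : ALMod.{v, u, w} Λ, FiniteDimensional ℂ K.H ∧ K.PiRep.Isomorphic ρ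

/-- The intersection of all complete submodules of `UL`; the smallest complete submodule, if there
is one. -/
def sigmaSpace (ρ : OLRep.{v, u, w} Λ) : Submodule ℂ ρ.toMod.H :=
  sInf {S | ρ.toMod.IsCompleteSubmodule S}

theorem sigmaSpace_isSubmodule (ρ : OLRep.{v, u, w} Λ) : ρ.toMod.IsSubmodule ρ.sigmaSpace where
  isClosed := by
    rw [sigmaSpace, Submodule.coe_sInf]
    exact isClosed_biInter fun S hS => hS.isClosed
  map_mem := fun f ξ hξ => by
    rw [sigmaSpace, Submodule.mem_sInf] at hξ ⊢
    exact fun S hS => hS.map_mem f ξ (hξ S hS)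

/-- The module `Σ(L)`. -/
def SigmaMod (ρ : OLRep.{v, u, w} Λ) : ALMod.{v, u, w} Λ :=
  ALMod.restrict ρ.sigmaSpace_isSubmodule

end OLRep

end

/-! In a representation, every tree `t` at `a` gives an isometry `x ↦ (X_μ^* x)_{μ ∈ t}` on `X_a L`,
with inverse formula `x = ∑ X_μ X_μ^* x`. Approximating the coordinates of `x` on a tree by vectors
of `S` is therefore the same as approximating `x` by sums of vectors `X_μ η` with `η ∈ S`. Hence a
closed invariant subspace is complete exactly when it generates `L` (`isCompleteSubmodule_iff`); the
converse direction uses that `X_τ^* X_λ` is either some `X_ν^*` or `0` once `τ ∈ Λ^{≤ n}` with `n ≥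
d(λ)`.

The decisive fact is that `K ⊓ S` is complete when `K` and `S` are and `K` has finite dimension
(`IsCompleteSubmodule.inf`). For `ξ ∈ K`, completeness of `S` yields a tree on which the vectors
`X_μ^* ξ`, which stay in `K`, are close to `S`. In finite dimension a vector of `K` at distance `δ`
from `S` is at distance at most `C δ` from `K ⊓ S`, with `C` independent of the tree. A finite
dimensional complete submodule of least dimension is thus contained in every complete submodule: it
is `Σ(L)`.

Complete submodules and modules `K` with `Π(K) ≃ L` are then compared in both directions. A complete
submodule `S` satisfies `Π(S) ≃ L`, since the form defining `Π(S)` computes inner products in `L`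
(`PiRep_restrict_isomorphic`). Conversely, an isomorphism `Π(K) ≃ L` carries the copy `ξ ↦ [a, ξ]`
of `K` to a complete submodule whose dimension vector is at most that of `K`
(`isCompleteSubmodule_image`, `dimVec_restrict_image_le`). Both minima are therefore attained at
`Σ(L)`, and finite Pythagorean dimension supplies the finite dimensional complete submodule that
starts the argument. -/

namespace KGraph

open scoped Classical

variable {k : ℕ} {V : Type u} [Category.{v} V] (Λ : KGraph k V)

/-! ### Combinatorics of trees -/

theorem extend_injective (Λ : KGraph k V) {a : V} (μ : PathInto a) :
    Function.Injective μ.extend := by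
  rintro ⟨c, g⟩ ⟨c', g'⟩ h
  have h1 : c = c' := congrArg (fun x => x.1) h
  subst h1
  have h2 : g ≫ μ.2 = g' ≫ μ.2 := by simpa [PathInto.extend] using h
  rw [Λ.cancel h2]

theorem extend_extend {a : V} (μ : PathInto a) (α : PathInto μ.1) (β : PathInto α.1) :
    (μ.extend α).extend β = μ.extend (α.extend β) := by simp [PathInto.extend]

/-- Paths of equal degree with a common extension are equal. -/
theorem eq_of_extend_eq {a : V} {p q : PathInto a} (hd : Λ.deg p.2 = Λ.deg q.2)
    {β : PathInto p.1} {γ : PathInto q.1} (h : p.extend β = q.extend γ) : p = q := by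
  obtain ⟨b, f⟩ := p
  obtain ⟨b', f'⟩ := q
  obtain ⟨c, g⟩ := β
  obtain ⟨c', g'⟩ := γ
  have h1 : c = c' := congrArg (fun x => x.1) h
  subst h1
  have h2 : g ≫ f = g' ≫ f' := by simpa [PathInto.extend] using h
  have h3 := Λ.factor_unique h2 hd
  have h4 : b = b' := congrArg (fun x => x.1) h3
  subst h4
  simp only [Sigma.mk.injEq, heq_eq_eq, Prod.mk.injEq, true_and] at h3
  rw [h3.2]

theorem deg_eq_of_mem_caret [Λ.RowFinite] {a : V} {i : Fin k} {α β : PathInto a}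
    (hα : α ∈ Λ.caret a i) (hβ : β ∈ Λ.caret a i) : Λ.deg α.2 = Λ.deg β.2 := by
  rcases Λ.mem_caret.1 hα with h1 | ⟨h1, h2⟩ <;> rcases Λ.mem_caret.1 hβ with h3 | ⟨h3, h4⟩
  · rw [h1, h3]
  · exact (h4.false ⟨α, h1⟩).elim
  · exact (h2.false ⟨β, h3⟩).elim
  · rw [h1, h3]

/-- Distinct leaves of a tree have no common extension. -/
theorem IsTree.eq_of_extend_eq {Λ : KGraph k V} [Λ.RowFinite] {a : V} {t : Finset (PathInto a)}
    (ht : Λ.IsTree a t) : ∀ μ ∈ t, ∀ ν ∈ t, ∀ (β : PathInto μ.1) (γ : PathInto ν.1),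
      μ.extend β = ν.extend γ → μ = ν := by
  induction ht with
  | trivial =>
    intro μ hμ ν hν _ _ _
    rw [Finset.mem_singleton.1 hμ, Finset.mem_singleton.1 hν]
  | glue t σ i _ hσ ih =>
    -- A common extension of `μ` and of a new leaf `σ ∘ α` is also one of `μ` and `σ`, which the
    -- induction hypothesis excludes.
    have mixed : ∀ μ ∈ t.erase σ, ∀ α : PathInto σ.1, ∀ (β : PathInto μ.1)
        (γ : PathInto (σ.extend α).1), μ.extend β ≠ (σ.extend α).extend γ := by
      intro μ hμ α β γ h
      rw [extend_extend] at h
      exact (Finset.mem_erase.1 hμ).1 (ih μ (Finset.mem_of_mem_erase hμ) σ hσ _ _ h)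
    intro μ hμ ν hν β γ h
    rcases Finset.mem_union.1 hμ with hμ | hμ <;> rcases Finset.mem_union.1 hν with hν | hν
    · exact ih μ (Finset.mem_of_mem_erase hμ) ν (Finset.mem_of_mem_erase hν) β γ h
    · obtain ⟨α, -, rfl⟩ := Finset.mem_image.1 hν
      exact (mixed μ hμ α β γ h).elim
    · obtain ⟨α, -, rfl⟩ := Finset.mem_image.1 hμ
      exact (mixed ν hν α γ β h.symm).elim
    · obtain ⟨α, hα, rfl⟩ := Finset.mem_image.1 hμ
      obtain ⟨α', hα', rfl⟩ := Finset.mem_image.1 hν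
      rw [extend_extend, extend_extend] at h
      rw [Λ.eq_of_extend_eq (Λ.deg_eq_of_mem_caret hα hα') (Λ.extend_injective σ h)]

theorem extend_id {a : V} (μ : PathInto a) : μ.extend ⟨μ.1, 𝟙 μ.1⟩ = μ := by
  simp [PathInto.extend]

/-- A quantity that is additive over carets is additive over trees. -/
theorem IsTree.sum_eq {Λ : KGraph k V} [Λ.RowFinite] {R : Type*} [AddCommMonoid R] {a : V}
    {t : Finset (PathInto a)} (ht : Λ.IsTree a t) (F : PathInto a → R)
    (hF : ∀ (μ : PathInto a) (i : Fin k), ∑ α ∈ Λ.caret μ.1 i, F (μ.extend α) = F μ) :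
    ∑ μ ∈ t, F μ = F ⟨a, 𝟙 a⟩ := by
  induction ht with
  | trivial => rw [Finset.sum_singleton]
  | glue t σ i ht hσ ih =>
    rw [Finset.sum_union, Finset.sum_image fun x _ y _ h => Λ.extend_injective σ h, hF,
      Finset.sum_erase_add _ _ hσ, ih]
    -- No new leaf `σ ∘ α` coincides with another old leaf, since that leaf and `σ` would have a
    -- common extension.
    rw [Finset.disjoint_left]
    intro μ hμ hμ'
    obtain ⟨α, -, rfl⟩ := Finset.mem_image.1 hμ'
    exact (Finset.mem_erase.1 hμ).1 (ht.eq_of_extend_eq _ (Finset.mem_of_mem_erase hμ) σ hσ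
      ⟨_, 𝟙 _⟩ α (extend_id _))

theorem leaves_zero [Λ.RowFinite] (a : V) : Λ.leaves a 0 = {⟨a, 𝟙 a⟩} := by
  ext p
  rw [mem_leaves, Finset.mem_singleton]
  constructor
  · exact fun h => Λ.eq_id_of_deg p.2 (le_antisymm h.1 (zero_le (a := Λ.deg p.2)))
  · rintro rfl
    exact ⟨(Λ.deg_id a).le, fun i hi => absurd hi (by simp)⟩

/-- The sets `aΛ^{≤ n}` are trees. -/
theorem isTree_leaves [Λ.RowFinite] [Λ.LocallyConvex] (a : V) (n : Fin k → ℕ) :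
    Λ.IsTree a (Λ.leaves a n) := by
  refine le_induction (n := 0) (P := fun n => Λ.IsTree a (Λ.leaves a n)) ?_ ?_ (zero_le (a := n))
  · show Λ.IsTree a (Λ.leaves a 0)
    rw [leaves_zero]; exact IsTree.trivial
  intro n _ i ih
  -- Raising `n` by one in colour `i` glues a caret at every leaf. Gluing one leaf at a time, `s` is
  -- the set of leaves already treated.
  have key : ∀ s : Finset (PathInto a), s ⊆ Λ.leaves a n → Λ.IsTree a
      ((Λ.leaves a n \ s) ∪ s.biUnion fun μ => (Λ.caret μ.1 i).image μ.extend) := by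
    intro s
    induction s using Finset.induction_on with
    | empty => intro _; simpa using ih
    | insert σ s hσ ihs =>
      intro hs
      have hσn : σ ∈ Λ.leaves a n := hs (Finset.mem_insert_self _ _)
      have h1 := (ihs ((Finset.subset_insert _ _).trans hs)).glue _ σ i
        (Finset.mem_union_left _ (Finset.mem_sdiff.2 ⟨hσn, hσ⟩))
      convert h1 using 1
      -- Erasing `σ` must not remove a path produced by an earlier gluing.
      have h2 : σ ∉ s.biUnion fun μ => (Λ.caret μ.1 i).image μ.extend := by
        intro h
        obtain ⟨ν, hν, h⟩ := Finset.mem_biUnion.1 h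
        obtain ⟨α, -, h⟩ := Finset.mem_image.1 h
        have := ih.eq_of_extend_eq _ hσn ν (hs (Finset.mem_insert_of_mem hν)) ⟨_, 𝟙 _⟩ α
          ((extend_id σ).trans h.symm)
        exact hσ (this ▸ hν)
      rw [Finset.erase_union_distrib, Finset.erase_eq_of_notMem h2, Finset.biUnion_insert,
        Finset.sdiff_insert, Finset.union_comm ((Λ.caret σ.1 i).image _), Finset.union_assoc]
  convert key _ subset_rfl using 1
  ext p
  simp only [mem_leaves, Λ.maximal_step i p, sdiff_self, Finset.bot_eq_empty, Finset.empty_union,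
    Finset.mem_biUnion, Finset.mem_image]

end KGraph

/-! ### Tree identities in a representation -/

namespace OLRep

open scoped Classical

variable {k : ℕ} {V : Type u} [Category.{v} V] {Λ : KGraph k V} [Λ.RowFinite]
variable (ρ : OLRep.{v, u, w} Λ)

theorem X_X {a b c : V} (g : a ⟶ b) (f : b ⟶ c) (x : ρ.L) :
    ρ.X f (ρ.X g x) = ρ.X (g ≫ f) x :=
  congrArg (fun T : ρ.L →L[ℂ] ρ.L => T x) (ρ.map_comp g f)

theorem adjoint_X_X {a b : V} (f : a ⟶ b) (x : ρ.L) :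
    adjoint (ρ.X f) (ρ.X f x) = ρ.X (𝟙 a) x :=
  congrArg (fun T : ρ.L →L[ℂ] ρ.L => T x) (ρ.adjoint_comp_self f)

theorem adjoint_X_id (a : V) : adjoint (ρ.X (𝟙 a)) = ρ.X (𝟙 a) :=
  (ρ.isStarProjection a).isSelfAdjoint.adjoint_eq

theorem adjoint_adjoint_X {a b c : V} (g : a ⟶ b) (f : b ⟶ c) (x : ρ.L) :
    adjoint (ρ.X g) (adjoint (ρ.X f) x) = adjoint (ρ.X (g ≫ f)) x := by
  rw [← ρ.map_comp g f, adjoint_comp]; rfl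

theorem X_id_adjoint {a b : V} (f : a ⟶ b) (x : ρ.L) :
    ρ.X (𝟙 a) (adjoint (ρ.X f) x) = adjoint (ρ.X f) x := by
  rw [← adjoint_X_id, adjoint_adjoint_X, Category.id_comp]

theorem X_id_X {a b : V} (f : a ⟶ b) (x : ρ.L) : ρ.X (𝟙 b) (ρ.X f x) = ρ.X f x := by
  rw [X_X, Category.comp_id]

theorem X_X_id {a b : V} (f : a ⟶ b) (x : ρ.L) : ρ.X f (ρ.X (𝟙 a) x) = ρ.X f x := by
  rw [X_X, Category.id_comp]

theorem adjoint_X_X_id {a b : V} (f : a ⟶ b) (x : ρ.L) :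
    adjoint (ρ.X f) (ρ.X (𝟙 b) x) = adjoint (ρ.X f) x := by
  conv_lhs => rw [← adjoint_X_id, adjoint_adjoint_X, Category.comp_id]

theorem X_id_X_id_of_ne {a b : V} (h : a ≠ b) (x : ρ.L) : ρ.X (𝟙 a) (ρ.X (𝟙 b) x) = 0 :=
  congrArg (fun T : ρ.L →L[ℂ] ρ.L => T x) (ρ.orthogonal a b h)

theorem X_id_X_of_ne {a b c : V} (f : b ⟶ c) (h : a ≠ c) (x : ρ.L) :
    ρ.X (𝟙 a) (ρ.X f x) = 0 := by
  rw [← X_id_X ρ f, X_id_X_id_of_ne ρ h]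

theorem X_id_adjoint_of_ne {a b c : V} (f : b ⟶ c) (h : a ≠ b) (x : ρ.L) :
    ρ.X (𝟙 a) (adjoint (ρ.X f) x) = 0 := by
  rw [← X_id_adjoint ρ f, X_id_X_id_of_ne ρ h]

theorem adjoint_X_X_of_ne {a b c d : V} (g : d ⟶ a) (f : b ⟶ c) (h : a ≠ c) (x : ρ.L) :
    adjoint (ρ.X g) (ρ.X f x) = 0 := by
  rw [← adjoint_X_X_id, X_id_X_of_ne ρ f h, map_zero]

theorem inner_X_X {a b : V} (f : a ⟶ b) (x y : ρ.L) :
    inner ℂ (ρ.X f x) (ρ.X f y) = inner ℂ (ρ.X (𝟙 a) x) y := by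
  rw [← adjoint_inner_left, adjoint_X_X]

theorem norm_X {a b : V} (f : a ⟶ b) (x : ρ.L) : ‖ρ.X f x‖ = ‖ρ.X (𝟙 a) x‖ := by
  rw [← sq_eq_sq₀ (norm_nonneg _) (norm_nonneg _), ← inner_self_eq_norm_sq (𝕜 := ℂ),
    ← inner_self_eq_norm_sq (𝕜 := ℂ), inner_X_X, inner_X_X]

theorem norm_X_id_le (a : V) (x : ρ.L) : ‖ρ.X (𝟙 a) x‖ ≤ ‖x‖ := by
  have h1 : ‖ρ.X (𝟙 a) x‖ ^ 2 ≤ ‖ρ.X (𝟙 a) x‖ * ‖x‖ := by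
    rw [← inner_self_eq_norm_sq (𝕜 := ℂ), inner_X_X]
    exact re_inner_le_norm _ _
  nlinarith [norm_nonneg (ρ.X (𝟙 a) x), norm_nonneg x]

/-- The trivial path is the value of `caret` when there is no edge of colour `i`, so the relation
holds for every colour without a nonemptiness hypothesis. -/
theorem sum_caret_X {a : V} (i : Fin k) (x : ρ.L) :
    ∑ α ∈ Λ.caret a i, ρ.X α.2 (adjoint (ρ.X α.2) x) = ρ.X (𝟙 a) x := by
  unfold KGraph.caret
  split_ifs with h
  · rw [Finset.sum_image (fun x _ y _ h => Subtype.ext h), ρ.sum_comp_adjoint a i h, sum_apply]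
    rfl
  · rw [Finset.sum_singleton, adjoint_X_id, X_X, Category.id_comp]

variable {ρ}

theorem sum_tree_X {a : V} {t : Finset (PathInto a)} (ht : Λ.IsTree a t) (x : ρ.L) :
    ∑ μ ∈ t, ρ.X μ.2 (adjoint (ρ.X μ.2) x) = ρ.X (𝟙 a) x := by
  rw [ht.sum_eq (fun μ => ρ.X μ.2 (adjoint (ρ.X μ.2) x))]
  · rw [adjoint_X_id, X_X, Category.id_comp]
  · intro μ i
    have h := congrArg (ρ.X μ.2) (ρ.sum_caret_X (a := μ.1) i (adjoint (ρ.X μ.2) x))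
    rw [map_sum, X_X_id] at h
    rw [← h]
    refine Finset.sum_congr rfl fun α _ => ?_
    rw [X_X, adjoint_adjoint_X]

theorem sum_tree_inner {a : V} {t : Finset (PathInto a)} (ht : Λ.IsTree a t) (x y : ρ.L) :
    ∑ μ ∈ t, inner ℂ (adjoint (ρ.X μ.2) x) (adjoint (ρ.X μ.2) y) = inner ℂ (ρ.X (𝟙 a) x) y := by
  rw [← sum_tree_X ht, sum_inner]
  refine Finset.sum_congr rfl fun μ _ => ?_
  rw [adjoint_inner_right]

/-- Parseval's identity for the coordinates `X_μ^* x` on a tree. -/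
theorem sum_tree_norm_sq {a : V} {t : Finset (PathInto a)} (ht : Λ.IsTree a t) (x : ρ.L) :
    ∑ μ ∈ t, ‖adjoint (ρ.X μ.2) x‖ ^ 2 = ‖ρ.X (𝟙 a) x‖ ^ 2 := by
  have h := congrArg RCLike.re (sum_tree_inner ht x (ρ.X (𝟙 a) x))
  simp only [adjoint_X_X_id, map_sum, inner_self_eq_norm_sq] at h
  exact h

/-- The isometries of distinct leaves of a tree have orthogonal ranges. -/
theorem adjoint_X_X_of_tree {a : V} {t : Finset (PathInto a)} (ht : Λ.IsTree a t)
    {σ τ : PathInto a} (hσ : σ ∈ t) (hτ : τ ∈ t) (hne : σ ≠ τ) (x : ρ.L) :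
    adjoint (ρ.X σ.2) (ρ.X τ.2 x) = 0 := by
  -- The coordinate of `X_τ x` at `τ` already carries its full norm, so by Parseval all other
  -- coordinates vanish.
  have h := sum_tree_norm_sq ht (ρ.X τ.2 x)
  rw [← Finset.add_sum_erase _ _ hτ, adjoint_X_X, X_id_X, ρ.norm_X τ.2, add_eq_left] at h
  have h1 := (Finset.sum_eq_zero_iff_of_nonneg fun _ _ => sq_nonneg _).1 h σ
    (Finset.mem_erase.2 ⟨hne, hσ⟩)
  simpa using h1

/-- The map `ζ ↦ ∑ X_μ ζ_μ` is adjoint to the contraction `x ↦ (X_μ^* x)`, hence a contraction.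
Equality can fail because `ζ μ` need not lie in the range of `X_{s(μ)}`. The direct sum is avoided
by bounding `‖z‖² = ∑ Re ⟨ζ_μ, X_μ^* z⟩` by half of `∑ ‖ζ_μ‖² + ‖z‖²`. -/
theorem norm_sq_sum_tree_le {a : V} {t : Finset (PathInto a)} (ht : Λ.IsTree a t)
    (ζ : PathInto a → ρ.L) : ‖∑ μ ∈ t, ρ.X μ.2 (ζ μ)‖ ^ 2 ≤ ∑ μ ∈ t, ‖ζ μ‖ ^ 2 := by
  set z := ∑ μ ∈ t, ρ.X μ.2 (ζ μ) with hz
  have h1 : ‖z‖ ^ 2 = ∑ μ ∈ t, RCLike.re (inner ℂ (ζ μ) (adjoint (ρ.X μ.2) z)) := by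
    rw [← inner_self_eq_norm_sq (𝕜 := ℂ) z]
    conv_lhs => enter [2, 2]; rw [hz]
    rw [sum_inner, map_sum]
    refine Finset.sum_congr rfl fun μ _ => ?_
    rw [adjoint_inner_right]
  have h2 : ∀ μ ∈ t, RCLike.re (inner ℂ (ζ μ) (adjoint (ρ.X μ.2) z)) ≤
      (‖ζ μ‖ ^ 2 + ‖adjoint (ρ.X μ.2) z‖ ^ 2) / 2 := fun μ _ => by
    have := re_inner_le_norm (𝕜 := ℂ) (ζ μ) (adjoint (ρ.X μ.2) z)
    nlinarith [sq_nonneg (‖ζ μ‖ - ‖adjoint (ρ.X μ.2) z‖)]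
  have h3 := Finset.sum_le_sum h2
  rw [← h1, ← Finset.sum_div, Finset.sum_add_distrib, sum_tree_norm_sq ht] at h3
  have h4 := pow_le_pow_left₀ (norm_nonneg _) (ρ.norm_X_id_le a z) 2
  linarith

end OLRep

/-! ### Complete submodules as generating subspaces -/

namespace OLRep

open scoped Classical

variable {k : ℕ} {V : Type u} [Category.{v} V] {Λ : KGraph k V} [Λ.RowFinite]
variable (ρ : OLRep.{v, u, w} Λ)

/-- The linear span of the vectors `X_λ η` with `η ∈ S`. -/
def genSpan (S : Submodule ℂ ρ.L) : Submodule ℂ ρ.L :=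
  Submodule.span ℂ {y | ∃ (a b : V) (f : a ⟶ b), ∃ η ∈ S, ρ.X f η = y}

variable {ρ}

theorem X_mem_genSpan {S : Submodule ℂ ρ.L} {a b : V} (f : a ⟶ b) {η : ρ.L} (hη : η ∈ S) :
    ρ.X f η ∈ ρ.genSpan S := Submodule.subset_span ⟨a, b, f, η, hη, rfl⟩

theorem X_mem_genSpan_of_mem {S : Submodule ℂ ρ.L} {a b : V} (f : a ⟶ b) {x : ρ.L}
    (hx : x ∈ ρ.genSpan S) : ρ.X f x ∈ ρ.genSpan S := by
  have h : ρ.genSpan S ≤ (ρ.genSpan S).comap (ρ.X f).toLinearMap := by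
    refine Submodule.span_le.2 ?_
    rintro _ ⟨c, d, g, η, hη, rfl⟩
    show ρ.X f (ρ.X g η) ∈ ρ.genSpan S
    by_cases h : d = a
    · subst h
      rw [X_X]
      exact X_mem_genSpan _ hη
    · rw [← X_X_id, X_id_X_of_ne ρ g (Ne.symm h), map_zero]
      exact zero_mem _
  exact h hx

theorem X_mem_closure_genSpan {S : Submodule ℂ ρ.L} {a b : V} (f : a ⟶ b) {x : ρ.L}
    (hx : x ∈ (ρ.genSpan S).topologicalClosure) :
    ρ.X f x ∈ (ρ.genSpan S).topologicalClosure :=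
  map_mem_closure (ρ.X f).continuous hx fun _ h => X_mem_genSpan_of_mem f h

/-- A closed subspace that contains the vectors `X_a x` contains `x`. -/
theorem mem_of_X_id_mem {S : Submodule ℂ ρ.L} (hS : IsClosed (S : Set ρ.L)) {x : ρ.L}
    (h : ∀ a, ρ.X (𝟙 a) x ∈ S) : x ∈ S :=
  hS.mem_of_tendsto (ρ.nondegenerate x) (Filter.Eventually.of_forall fun _ =>
    S.sum_mem fun a _ => h a)

variable (ρ) in
/-- The operator `X_ν^*` if `τ = p ∘ ν`, and `0` if `τ` does not extend `p`. -/
noncomputable def cut {a : V} (p τ : PathInto a) : ρ.L →L[ℂ] ρ.L := ρ.toMod.cut p τ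

theorem cut_of_eq {a : V} {p τ : PathInto a} (ν : τ.1 ⟶ p.1) (h : ν ≫ p.2 = τ.2) :
    ρ.cut p τ = adjoint (ρ.X ν) := ρ.toMod.cut_of_eq ν h

theorem cut_of_not {a : V} {p τ : PathInto a} (h : ¬ ∃ ν : τ.1 ⟶ p.1, ν ≫ p.2 = τ.2) :
    ρ.cut p τ = 0 := ρ.toMod.cut_of_not h

theorem cut_extend {a : V} {p σ : PathInto a} {n : Fin k → ℕ} (hp : Λ.deg p.2 ≤ n)
    (hσ : Λ.Maximal n σ) (α : PathInto σ.1) :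
    ρ.cut p (σ.extend α) = adjoint (ρ.X α.2) ∘L ρ.cut p σ := ρ.toMod.cut_extend hp hσ α

theorem X_id_cut {a : V} (p τ : PathInto a) (x : ρ.L) :
    ρ.X (𝟙 τ.1) (ρ.cut p τ x) = ρ.cut p τ x := by
  by_cases h : ∃ ν : τ.1 ⟶ p.1, ν ≫ p.2 = τ.2
  · obtain ⟨ν, hν⟩ := h
    rw [cut_of_eq ν hν, X_id_adjoint]
  · rw [cut_of_not h, zero_apply, map_zero]

/-- At `n = d(p)` the only leaf that extends `p` is `p` itself. Each increase of `n` by one colour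
then splits every term by the caret relation at its leaf. -/
theorem sum_leaves_cut [Λ.LocallyConvex] {a : V} (p : PathInto a) {n : Fin k → ℕ}
    (hn : Λ.deg p.2 ≤ n) (x : ρ.L) :
    ∑ τ ∈ Λ.leaves a n, ρ.X τ.2 (ρ.cut p τ (ρ.X (𝟙 p.1) x)) = ρ.X p.2 x := by
  refine KGraph.le_induction (P := fun n => ∑ τ ∈ Λ.leaves a n,
    ρ.X τ.2 (ρ.cut p τ (ρ.X (𝟙 p.1) x)) = ρ.X p.2 x) ?_ ?_ hn
  · rw [Finset.sum_eq_single p]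
    · rw [cut_of_eq (𝟙 p.1) (by simp)]
      rw [adjoint_X_id, X_X_id, X_X_id]
    · intro τ hτ hne
      rw [cut_of_not]
      · exact map_zero _
      · rintro ⟨ν, hν⟩
        apply hne
        have h1 := (Λ.mem_leaves.1 hτ).1
        rw [← hν, Λ.deg_comp] at h1
        have h2 : Λ.deg ν = 0 := by
          funext j
          have := h1 j
          simp only [Pi.add_apply] at this
          simpa using this
        have h3 : Λ.deg p.2 = Λ.deg τ.2 := by rw [← hν, Λ.deg_comp, h2, add_zero]
        refine (Λ.eq_of_extend_eq h3 (β := ⟨τ.1, ν⟩) (γ := ⟨τ.1, 𝟙 _⟩) ?_).symm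
        rw [KGraph.extend_id]
        simp [PathInto.extend, hν]
    · intro h
      exact (h (Λ.mem_leaves.2 ⟨le_rfl, fun i hi => absurd hi (lt_irrefl _)⟩)).elim
  · intro m hm i ih
    rw [← ih, Λ.sum_leaves_step]
    refine Finset.sum_congr rfl fun σ hσ => ?_
    have h := congrArg (ρ.X σ.2) (ρ.sum_caret_X (a := σ.1) i
      (ρ.cut p σ (ρ.X (𝟙 p.1) x)))
    rw [map_sum, X_X_id] at h
    rw [← h]
    refine Finset.sum_congr rfl fun α _ => ?_
    rw [cut_extend hm (Λ.mem_leaves.1 hσ), X_X]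
    rfl

/-- Orthogonality of the leaves reads off one term of `sum_leaves_cut`. Thus `X_τ^* X_p` involves
only an adjoint `X_ν^*`, under which submodules of `UL` are invariant. -/
theorem adjoint_leaf_X [Λ.LocallyConvex] {a : V} (p : PathInto a) {n : Fin k → ℕ}
    (hn : Λ.deg p.2 ≤ n) {τ : PathInto a} (hτ : τ ∈ Λ.leaves a n) (x : ρ.L) :
    adjoint (ρ.X τ.2) (ρ.X p.2 x) = ρ.cut p τ (ρ.X (𝟙 p.1) x) := by
  rw [← sum_leaves_cut p hn, map_sum, Finset.sum_eq_single τ]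
  · rw [adjoint_X_X, X_id_cut]
  · intro σ hσ hne
    exact adjoint_X_X_of_tree (Λ.isTree_leaves a n) hτ hσ hne.symm _
  · exact fun h => (h hτ).elim

theorem cut_mem {S : Submodule ℂ ρ.L} (hS : ∀ {a b : V} (f : a ⟶ b), ∀ ξ ∈ S,
    adjoint (ρ.X f) ξ ∈ S) {a : V} (p τ : PathInto a) {x : ρ.L} (hx : x ∈ S) :
    ρ.cut p τ x ∈ S := by
  by_cases h : ∃ ν : τ.1 ⟶ p.1, ν ≫ p.2 = τ.2
  · obtain ⟨ν, hν⟩ := h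
    rw [cut_of_eq ν hν]
    exact hS _ _ hx
  · rw [cut_of_not h]
    exact zero_mem S

/-- On a generator `X_f η` the degree of `f` serves as `n`, by `adjoint_leaf_X` and the invariance
of `S`. The claim is made for all `m ≥ n` so that the bounds of two summands can be joined. -/
theorem exists_adjoint_leaf_mem [Λ.LocallyConvex] {S : Submodule ℂ ρ.L}
    (hS : ∀ {a b : V} (f : a ⟶ b), ∀ ξ ∈ S, adjoint (ρ.X f) ξ ∈ S) {x : ρ.L}
    (hx : x ∈ ρ.genSpan S) : ∃ n : Fin k → ℕ, ∀ m, n ≤ m → ∀ a, ∀ τ ∈ Λ.leaves a m,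
      adjoint (ρ.X τ.2) x ∈ S := by
  induction hx using Submodule.span_induction with
  | mem x hx =>
    obtain ⟨c, b, f, η, hη, rfl⟩ := hx
    refine ⟨Λ.deg f, fun m hm a τ hτ => ?_⟩
    by_cases h : a = b
    · subst h
      rw [adjoint_leaf_X ⟨c, f⟩ hm hτ]
      refine cut_mem hS _ _ ?_
      rw [← adjoint_X_id]
      exact hS _ _ hη
    · rw [adjoint_X_X_of_ne ρ τ.2 f h]
      exact zero_mem S
  | zero => exact ⟨0, fun m _ a τ _ => by rw [map_zero]; exact zero_mem S⟩
  | add x y _ _ hx hy =>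
    obtain ⟨n, hn⟩ := hx
    obtain ⟨n', hn'⟩ := hy
    refine ⟨n + n', fun m hm a τ hτ => ?_⟩
    rw [map_add]
    exact add_mem (hn m (le_self_add.trans hm) a τ hτ) (hn' m (le_add_self.trans hm) a τ hτ)
  | smul c x _ hx =>
    obtain ⟨n, hn⟩ := hx
    refine ⟨n, fun m hm a τ hτ => ?_⟩
    rw [map_smul]
    exact S.smul_mem c (hn m hm a τ hτ)

theorem mem_fiber_toMod {a : V} {x : ρ.L} : x ∈ ρ.toMod.fiber a ↔ ρ.X (𝟙 a) x = x := by
  have h : ρ.toMod.A (𝟙 a) = ρ.X (𝟙 a) := ρ.adjoint_X_id a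
  constructor
  · exact fun hx => (congrArg (fun T : ρ.L →L[ℂ] ρ.L => T x) h).symm.trans
      (ρ.toMod.A_id_of_mem hx)
  · exact fun hx => ⟨x, (congrArg (fun T : ρ.L →L[ℂ] ρ.L => T x) h).trans hx⟩

/-- `IsCompleteSubmodule` for the module `UL`, in terms of the representation. -/
theorem isCompleteSubmodule_iff_exists_tree (S : Submodule ℂ ρ.L) :
    ρ.toMod.IsCompleteSubmodule S ↔ IsClosed (S : Set ρ.L) ∧
      (∀ {a b : V} (f : a ⟶ b), ∀ ξ ∈ S, adjoint (ρ.X f) ξ ∈ S) ∧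
      ∀ ε : ℝ, 0 < ε → ∀ a : V, ∀ ξ : ρ.L, ρ.X (𝟙 a) ξ = ξ →
        ∃ t : Finset (PathInto a), Λ.IsTree a t ∧ ∃ η : PathInto a → ρ.L,
          (∀ μ ∈ t, η μ ∈ S) ∧ ∑ μ ∈ t, ‖adjoint (ρ.X μ.2) ξ - η μ‖ ^ 2 < ε ^ 2 :=
  ⟨fun h => ⟨h.isClosed, h.map_mem, fun ε hε a ξ hξ =>
      h.exists_tree ε hε a ξ (mem_fiber_toMod.2 hξ)⟩,
    fun h => ⟨⟨h.1, h.2.1⟩, fun ε hε a ξ hξ => h.2.2 ε hε a ξ (mem_fiber_toMod.1 hξ)⟩⟩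

/-- A vector is approximated by a sum over a tree as well as its coordinates are. -/
theorem norm_sub_sum_tree_le {a : V} {t : Finset (PathInto a)} (ht : Λ.IsTree a t) {x : ρ.L}
    (hx : ρ.X (𝟙 a) x = x) (η : PathInto a → ρ.L) :
    ‖x - ∑ μ ∈ t, ρ.X μ.2 (η μ)‖ ^ 2 ≤ ∑ μ ∈ t, ‖adjoint (ρ.X μ.2) x - η μ‖ ^ 2 := by
  have h := norm_sq_sum_tree_le ht fun μ => adjoint (ρ.X μ.2) x - η μ
  simp only [map_sub, Finset.sum_sub_distrib] at h
  rwa [sum_tree_X ht, hx] at h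

/-- A closed invariant subspace is complete if and only if it generates the representation. -/
theorem isCompleteSubmodule_iff [Λ.LocallyConvex] (S : Submodule ℂ ρ.L) :
    ρ.toMod.IsCompleteSubmodule S ↔ IsClosed (S : Set ρ.L) ∧
      (∀ {a b : V} (f : a ⟶ b), ∀ ξ ∈ S, adjoint (ρ.X f) ξ ∈ S) ∧
      (ρ.genSpan S).topologicalClosure = ⊤ := by
  rw [isCompleteSubmodule_iff_exists_tree]
  constructor
  · rintro ⟨h1, h2, h3⟩
    refine ⟨h1, h2, eq_top_iff.2 fun x _ => ?_⟩
    -- Trees live at one vertex, so `x` is treated one component `X_a x` at a time.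
    refine mem_of_X_id_mem (Submodule.isClosed_topologicalClosure _) fun a => ?_
    refine Metric.mem_closure_iff.2 fun ε hε => ?_
    have hxa : ρ.X (𝟙 a) (ρ.X (𝟙 a) x) = ρ.X (𝟙 a) x := X_X_id ρ _ _
    obtain ⟨t, ht, η, hη, hlt⟩ := h3 ε hε a _ hxa
    refine ⟨∑ μ ∈ t, ρ.X μ.2 (η μ), Submodule.sum_mem _ fun μ hμ =>
      X_mem_genSpan _ (hη μ hμ), ?_⟩
    rw [dist_eq_norm]
    exact lt_of_pow_lt_pow_left₀ 2 hε.le ((norm_sub_sum_tree_le ht hxa η).trans_lt hlt)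
  · rintro ⟨h1, h2, h3⟩
    refine ⟨h1, h2, fun ε hε a x hx => ?_⟩
    have hx' : x ∈ (ρ.genSpan S).topologicalClosure := h3 ▸ Submodule.mem_top
    obtain ⟨y, hy, hxy⟩ := Metric.mem_closure_iff.1 hx' ε hε
    obtain ⟨n, hn⟩ := exists_adjoint_leaf_mem h2 hy
    -- For large `n` the coordinates of the approximant `y` on `aΛ^{≤ n}` lie in `S`, and by
    -- Parseval the error of the coordinates is at most `‖x - y‖`.
    refine ⟨Λ.leaves a n, Λ.isTree_leaves a n, fun τ => adjoint (ρ.X τ.2) y,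
      fun τ hτ => hn n le_rfl a τ hτ, ?_⟩
    have h4 := sum_tree_norm_sq (Λ.isTree_leaves a n) (x - y)
    simp only [map_sub] at h4
    refine h4.trans_lt ?_
    rw [← map_sub]
    refine pow_lt_pow_left₀ ((ρ.norm_X_id_le a _).trans_lt ?_) (norm_nonneg _) two_ne_zero
    rwa [dist_eq_norm] at hxy

end OLRep

/-! ### Intersections of complete submodules and the smallest one -/

/-- For a finite dimensional `K` and a closed `S`, vectors of `K` close to `S` are close to
`K ⊓ S`. -/
theorem Submodule.exists_mem_inf_norm_sub_le {E : Type*} [NormedAddCommGroup E]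
    [InnerProductSpace ℂ E] [CompleteSpace E] (K S : Submodule ℂ E) [FiniteDimensional ℂ K]
    (hS : IsClosed (S : Set E)) :
    ∃ C : ℝ, 0 < C ∧ ∀ x ∈ K, ∀ s ∈ S, ∃ y ∈ K ⊓ S, ‖x - y‖ ≤ C * ‖x - s‖ := by
  have : CompleteSpace S := hS.completeSpace_coe
  have : FiniteDimensional ℂ (K ⊓ S : Submodule ℂ E) :=
    Submodule.finiteDimensional_of_le inf_le_left
  have : FiniteDimensional ℂ (K ⊓ (K ⊓ S)ᗮ : Submodule ℂ E) :=
    Submodule.finiteDimensional_of_le inf_le_left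
  -- The projection onto `Sᗮ` is injective on the part of `K` orthogonal to `K ⊓ S`, since a vector
  -- in its kernel lies in `K ⊓ S` as well. In finite dimension injective means bounded below, which
  -- gives `C`.
  let g : (K ⊓ (K ⊓ S)ᗮ : Submodule ℂ E) →ₗ[ℂ] E :=
    Sᗮ.starProjection.toLinearMap ∘ₗ (K ⊓ (K ⊓ S)ᗮ).subtype
  have hg : LinearMap.ker g = ⊥ := by
    rw [LinearMap.ker_eq_bot']
    intro x hx
    have h1 : (x : E) ∈ S := by
      have : (x : E) ∈ Sᗮᗮ :=
        (Submodule.starProjection_apply_eq_zero_iff _).1 hx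
      rwa [Submodule.orthogonal_orthogonal] at this
    have h2 := Submodule.inner_right_of_mem_orthogonal (K := K ⊓ S) ⟨x.2.1, h1⟩ x.2.2
    exact Subtype.ext (inner_self_eq_zero.1 h2)
  obtain ⟨C, hC, hanti⟩ := LinearMap.exists_antilipschitzWith g hg
  refine ⟨C, hC, fun x hx s hs => ⟨(K ⊓ S).starProjection x,
    Submodule.starProjection_apply_mem _ _, ?_⟩⟩
  have hy : (K ⊓ S).starProjection x ∈ K ⊓ S := Submodule.starProjection_apply_mem _ _
  have h0 : ∀ z ∈ S, Sᗮ.starProjection z = 0 := fun z hz =>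
    (Submodule.starProjection_apply_eq_zero_iff _).2 (S.le_orthogonal_orthogonal hz)
  have h1 := hanti.le_mul_dist ⟨x - (K ⊓ S).starProjection x, K.sub_mem hx hy.1,
    Submodule.sub_starProjection_mem_orthogonal x⟩ 0
  rw [map_zero, dist_zero_right, dist_zero_right] at h1
  refine h1.trans (mul_le_mul_of_nonneg_left ?_ C.2)
  show ‖Sᗮ.starProjection (x - (K ⊓ S).starProjection x)‖ ≤ _
  -- The projection onto `Sᗮ` kills both `y` and `s`, so `x - y` and `x - s` have the same image.
  rw [map_sub, h0 _ hy.2, ← h0 s hs, ← map_sub]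
  exact Submodule.norm_starProjection_apply_le _ _

namespace OLRep

variable {k : ℕ} {V : Type u} [Category.{v} V] {Λ : KGraph k V} [Λ.RowFinite] [Λ.LocallyConvex]
variable {ρ : OLRep.{v, u, w} Λ}

/-- The coordinates of a vector of `K` stay in `K` and come close to `S` on a suitable tree. Finite
dimension of `K` turns this into closeness to `K ⊓ S`, with a constant that does not depend on the
tree or its size. -/
theorem IsCompleteSubmodule.inf {K S : Submodule ℂ ρ.L} [FiniteDimensional ℂ K]
    (hK : ρ.toMod.IsCompleteSubmodule K) (hS : ρ.toMod.IsCompleteSubmodule S) :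
    ρ.toMod.IsCompleteSubmodule (K ⊓ S : Submodule ℂ ρ.L) := by
  obtain ⟨hK1, hK2, hK3⟩ := (isCompleteSubmodule_iff K).1 hK
  obtain ⟨hS1, hS2, hS3⟩ := (isCompleteSubmodule_iff_exists_tree S).1 hS
  refine (isCompleteSubmodule_iff _).2 ⟨hK1.inter hS1, fun f ξ hξ =>
    ⟨hK2 f ξ hξ.1, hS2 f ξ hξ.2⟩, ?_⟩
  obtain ⟨C, hC, hCK⟩ := Submodule.exists_mem_inf_norm_sub_le K S hS1
  -- This suffices: the right side is closed and invariant under all `X_λ`, and `K` generates `L`.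
  have key : K ≤ (ρ.genSpan (K ⊓ S)).topologicalClosure := by
    intro x hx
    refine mem_of_X_id_mem (Submodule.isClosed_topologicalClosure _) fun a => ?_
    have hxa : ρ.X (𝟙 a) (ρ.X (𝟙 a) x) = ρ.X (𝟙 a) x := X_X_id ρ _ _
    have hxK : ρ.X (𝟙 a) x ∈ K := by rw [← adjoint_X_id]; exact hK2 _ _ hx
    generalize ρ.X (𝟙 a) x = z at hxa hxK
    refine Metric.mem_closure_iff.2 fun ε hε => ?_
    -- The tolerance `ε / C` compensates the factor `C` lost in passing from `S` to `K ⊓ S`.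
    obtain ⟨t, ht, η, hη, hlt⟩ := hS3 (ε / C) (div_pos hε hC) a z hxa
    have hy : ∀ μ : PathInto a, ∃ y : ρ.L, μ ∈ t → y ∈ K ⊓ S ∧
        ‖adjoint (ρ.X μ.2) z - y‖ ≤ C * ‖adjoint (ρ.X μ.2) z - η μ‖ := by
      intro μ
      by_cases hμ : μ ∈ t
      · obtain ⟨y, h1, h2⟩ := hCK _ (hK2 μ.2 z hxK) (η μ) (hη μ hμ)
        exact ⟨y, fun _ => ⟨h1, h2⟩⟩
      · exact ⟨0, fun h => (hμ h).elim⟩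
    choose y hy using hy
    refine ⟨∑ μ ∈ t, ρ.X μ.2 (y μ), Submodule.sum_mem _ fun μ hμ =>
      X_mem_genSpan _ (hy μ hμ).1, ?_⟩
    rw [dist_eq_norm]
    refine lt_of_pow_lt_pow_left₀ 2 hε.le ((norm_sub_sum_tree_le ht hxa y).trans_lt ?_)
    calc ∑ μ ∈ t, ‖adjoint (ρ.X μ.2) z - y μ‖ ^ 2
        ≤ ∑ μ ∈ t, C ^ 2 * ‖adjoint (ρ.X μ.2) z - η μ‖ ^ 2 := by
          refine Finset.sum_le_sum fun μ hμ => ?_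
          rw [← mul_pow]
          exact pow_le_pow_left₀ (norm_nonneg _) (hy μ hμ).2 2
      _ < C ^ 2 * (ε / C) ^ 2 := by
          rw [← Finset.mul_sum]
          exact mul_lt_mul_of_pos_left hlt (by positivity)
      _ = ε ^ 2 := by field_simp
  rw [eq_top_iff, ← hK3]
  refine Submodule.topologicalClosure_minimal _ (Submodule.span_le.2 ?_)
    (Submodule.isClosed_topologicalClosure _)
  rintro _ ⟨a, b, f, η, hη, rfl⟩
  exact X_mem_closure_genSpan f (key hη)

/-- If there is a finite dimensional complete submodule, then there is a smallest complete
submodule. -/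
theorem isLeast_sigmaSpace {K : Submodule ℂ ρ.L} (hK : ρ.toMod.IsCompleteSubmodule K)
    (hfin : FiniteDimensional ℂ K) :
    IsLeast {S | ρ.toMod.IsCompleteSubmodule S} ρ.sigmaSpace := by
  classical
  have hex : ∃ n, ∃ K : Submodule ℂ ρ.L, ρ.toMod.IsCompleteSubmodule K ∧
      FiniteDimensional ℂ K ∧ Module.finrank ℂ K = n := ⟨_, K, hK, hfin, rfl⟩
  obtain ⟨N, hN, hNfin, hNn⟩ := Nat.find_spec hex
  -- `N` has least dimension among the finite dimensional complete submodules. As `N ⊓ S` is one of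
  -- them, it cannot be smaller than `N`.
  have hle : ∀ S : Submodule ℂ ρ.L, ρ.toMod.IsCompleteSubmodule S → N ≤ S := by
    intro S hS
    have h1 := Nat.find_min' hex ⟨N ⊓ S, IsCompleteSubmodule.inf hN hS,
      Submodule.finiteDimensional_of_le inf_le_left, rfl⟩
    rw [← hNn] at h1
    exact inf_eq_left.1 (Submodule.eq_of_le_of_finrank_le inf_le_left h1)
  have hσ : ρ.sigmaSpace = N := le_antisymm (sInf_le hN) (le_sInf hle)
  exact ⟨hσ ▸ hN, fun S hS => hσ ▸ hle S hS⟩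

end OLRep

/-! ### Lifting an embedding of a module into `UL` -/

namespace ALMod

open scoped Classical
open UniformSpace

variable {k : ℕ} {V : Type u} [Category.{v} V] {Λ : KGraph k V} [Λ.RowFinite]
variable (N : ALMod.{v, u, w'} Λ)

theorem eq_sum_pair {a : V} (x : N.Pre a) :
    x = ∑ p ∈ DFinsupp.support (show Π₀ p : PathInto a, N.fiber p.1 from x),
      N.pair p ((show Π₀ p : PathInto a, N.fiber p.1 from x) p) :=
  (DFinsupp.sum_single (f := show Π₀ p : PathInto a, N.fiber p.1 from x)).symm

/-- Continuous linear maps on the lifted representation that agree on the vectors `[λ, ξ]`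
are equal. -/
theorem lift_hom_ext [Λ.LocallyConvex] {E : Type*} [NormedAddCommGroup E] [NormedSpace ℂ E]
    {S T : N.Lift →L[ℂ] E} (h : ∀ (a : V) (p : PathInto a) (ξ : N.fiber p.1),
      S (N.incl a (N.pair p ξ : N.Pre a)) = T (N.incl a (N.pair p ξ : N.Pre a))) : S = T := by
  have h1 : ∀ a (x : N.LSpace a), S (N.incl a x) = T (N.incl a x) := by
    intro a x
    refine Completion.induction_on x (isClosed_eq (by fun_prop) (by fun_prop)) fun x => ?_
    refine N.pre_induction (P := fun x => S (N.incl a (x : N.Pre a)) = T (N.incl a (x : N.Pre a)))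
      ?_ (fun x y hx hy => ?_) (fun p ξ => h a p ξ) x
    · rw [Completion.coe_zero, map_zero, map_zero, map_zero]
    · rw [Completion.coe_add, map_add, map_add, map_add, hx, hy]
  ext x
  have hx := lp.hasSum_single (p := 2) (by norm_num) x
  refine (hx.mapL S).unique ?_
  convert hx.mapL T using 2 with a
  exact h1 a (x a)

variable {N} {ρ : OLRep.{v, u, w} Λ} (j : N.H →ₗᵢ[ℂ] ρ.L)

/-- The linear map `(λ, ξ) ↦ X_λ (j ξ)` on formal sums. -/
noncomputable def evalPre (a : V) : N.Pre a →ₗ[ℂ] ρ.L :=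
  N.preLift fun p => (ρ.X p.2).toLinearMap ∘ₗ j.toLinearMap ∘ₗ (N.fiber p.1).subtype

theorem evalPre_pair {a : V} (p : PathInto a) (ξ : N.fiber p.1) :
    evalPre j a (N.pair p ξ) = ρ.X p.2 (j ξ) := N.preLift_pair _ _ _

theorem X_id_evalPre {a : V} (x : N.Pre a) : ρ.X (𝟙 a) (evalPre j a x) = evalPre j a x := by
  refine N.pre_induction (P := fun x => ρ.X (𝟙 a) (evalPre j a x) = evalPre j a x)
    (by simp) (fun x y hx hy => ?_) (fun p ξ => ?_) x
  · rw [map_add, map_add, hx, hy]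
  · rw [evalPre_pair, OLRep.X_id_X]

/-- The isometry `j` intertwines the actions on `N` and on `UL`. -/
def Intertwines : Prop :=
  ∀ {a b : V} (f : a ⟶ b) (x : N.H), j (N.A f x) = adjoint (ρ.X f) (j x)

variable {j}

theorem map_cut (hj : Intertwines j) {a : V} (p τ : PathInto a) (x : N.H) :
    j (N.cut p τ x) = ρ.cut p τ (j x) := by
  by_cases h : ∃ ν : τ.1 ⟶ p.1, ν ≫ p.2 = τ.2
  · obtain ⟨ν, hν⟩ := h
    rw [N.cut_of_eq ν hν, OLRep.cut_of_eq ν hν, hj]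
  · rw [N.cut_of_not h, OLRep.cut_of_not h, zero_apply, zero_apply, map_zero]

theorem X_id_map (hj : Intertwines j) {a : V} {x : N.H} (hx : x ∈ N.fiber a) :
    ρ.X (𝟙 a) (j x) = j x := by
  rw [← ρ.adjoint_X_id, ← hj, N.A_id_of_mem hx]

variable [Λ.LocallyConvex]

/-- The formal coordinates that define the form of `Π(N)` are the actual tree coordinates of the
evaluated vector, up to `j`. With `OLRep.sum_tree_inner` this makes the evaluation isometric. -/
theorem adjoint_leaf_evalPre (hj : Intertwines j) {a : V} {x : N.Pre a} {n : Fin k → ℕ}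
    (hn : N.degBound x ≤ n)
    {τ : PathInto a} (hτ : τ ∈ Λ.leaves a n) :
    adjoint (ρ.X τ.2) (evalPre j a x) = j (N.coord τ x) := by
  have hx' := Finset.sup_le_iff.1 hn
  rw [N.eq_sum_pair x]
  simp only [map_sum, coord_pair, evalPre_pair]
  refine Finset.sum_congr rfl fun p hp => ?_
  rw [OLRep.adjoint_leaf_X p (hx' p hp) hτ, X_id_map hj (SetLike.coe_mem _), map_cut hj]

theorem inner_evalPre (hj : Intertwines j) {a : V} (x y : N.Pre a) :
    inner ℂ (evalPre j a x) (evalPre j a y) = inner ℂ x y := by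
  have hx : N.degBound x ≤ N.degBound x + N.degBound y := le_self_add
  have hy : N.degBound y ≤ N.degBound x + N.degBound y := le_add_self
  rw [inner_eq_ip, N.ip_eq hx hy]
  rw [← X_id_evalPre j x,
    ← OLRep.sum_tree_inner (Λ.isTree_leaves a (N.degBound x + N.degBound y))]
  refine Finset.sum_congr rfl fun τ hτ => ?_
  rw [adjoint_leaf_evalPre hj hx hτ, adjoint_leaf_evalPre hj hy hτ, j.inner_map_map]

/-- The isometry `[λ, ξ] ↦ X_λ (j ξ)` on `L_a`. -/
noncomputable def evalL (hj : Intertwines j) (a : V) : N.LSpace a →ₗᵢ[ℂ] ρ.L :=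
  (((evalPre j a).isometryOfInner (inner_evalPre hj)).toContinuousLinearMap.fromCompletion
    |>.toLinearMap).isometryOfInner fun x y => by
      refine Completion.induction_on₂ x y (isClosed_eq ?_ ?_) fun x y => ?_
      · simp only [ContinuousLinearMap.coe_coe]; fun_prop
      · fun_prop
      · simp only [ContinuousLinearMap.coe_coe, fromCompletion_apply_coe, Completion.inner_coe]
        exact inner_evalPre hj x y

theorem evalL_coe (hj : Intertwines j) {a : V} (x : N.Pre a) :
    evalL hj a (x : N.LSpace a) = evalPre j a x :=
  fromCompletion_apply_coe _ _

theorem X_id_evalL (hj : Intertwines j) {a : V} (x : N.LSpace a) :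
    ρ.X (𝟙 a) (evalL hj a x) = evalL hj a x := by
  refine Completion.induction_on x (isClosed_eq (by fun_prop) (by fun_prop)) fun x => ?_
  rw [evalL_coe, X_id_evalPre]

theorem orthogonalFamily_evalL (hj : Intertwines j) :
    OrthogonalFamily ℂ (fun a => N.LSpace a) (evalL hj) := by
  intro a b hab x y
  rw [← X_id_evalL hj x, ← X_id_evalL hj y, ← adjoint_inner_right, ρ.adjoint_X_id,
    ρ.X_id_X_id_of_ne hab, inner_zero_right]

theorem linearIsometry_incl (hj : Intertwines j) (a : V) (x : N.LSpace a) :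
    (orthogonalFamily_evalL hj).linearIsometry (N.incl a x) = evalL hj a x :=
  (orthogonalFamily_evalL hj).linearIsometry_apply_single x

theorem linearIsometry_pair (hj : Intertwines j) {a : V} (p : PathInto a)
    (ξ : N.fiber p.1) :
    (orthogonalFamily_evalL hj).linearIsometry (N.incl a (N.pair p ξ : N.Pre a)) =
      ρ.X p.2 (j ξ) := by
  rw [linearIsometry_incl, evalL_coe, evalPre_pair]

/-- A module embedded isometrically in `UL` onto a generating subspace lifts to `L`. -/
theorem PiRep_isomorphic_of_embedding (hj : Intertwines j)
    (hgen : (ρ.genSpan (LinearMap.range j.toLinearMap)).topologicalClosure = ⊤) :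
    N.PiRep.Isomorphic ρ := by
  set Φ := (orthogonalFamily_evalL hj).linearIsometry
  have hsurj : Function.Surjective Φ := by
    have hcl : IsClosed (LinearMap.range Φ.toLinearMap : Set ρ.L) :=
      Φ.isometry.isClosedEmbedding.isClosed_range
    have h1 : ρ.genSpan (LinearMap.range j.toLinearMap) ≤ LinearMap.range Φ.toLinearMap := by
      refine Submodule.span_le.2 ?_
      rintro _ ⟨a, b, f, _, ⟨x, rfl⟩, rfl⟩
      refine ⟨N.incl b ((N.pair ⟨a, f⟩ ⟨N.A (𝟙 a) x, x, rfl⟩ : N.Pre b) : N.LSpace b), ?_⟩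
      refine (linearIsometry_pair hj _ _).trans ?_
      show ρ.X f (j (N.A (𝟙 a) x)) = ρ.X f (j x)
      rw [hj, ρ.adjoint_X_id, ρ.X_X_id]
    have h2 := Submodule.topologicalClosure_minimal _ h1 hcl
    rw [hgen] at h2
    exact fun y => h2 Submodule.mem_top
  have hX : ∀ {a b : V} (f : a ⟶ b) (x : N.Lift), Φ (N.liftX f x) = ρ.X f (Φ x) := by
    intro a b f x
    have : Φ.toContinuousLinearMap ∘L N.liftX f = ρ.X f ∘L Φ.toContinuousLinearMap := by
      refine N.lift_hom_ext fun c p ξ => ?_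
      show Φ (N.liftX f _) = ρ.X f (Φ _)
      rw [linearIsometry_pair]
      by_cases h : a = c
      · subst h
        rw [liftX, ContinuousLinearMap.comp_apply, ContinuousLinearMap.comp_apply,
          proj_incl_self, LMap_coe, shift_pair, linearIsometry_pair, ρ.X_X]
      · rw [liftX, ContinuousLinearMap.comp_apply, ContinuousLinearMap.comp_apply,
          proj_incl_of_ne _ h, map_zero, map_zero, map_zero, ← ρ.X_X_id,
          ρ.X_id_X_of_ne _ h, map_zero]
    exact congrArg (fun T : N.Lift →L[ℂ] ρ.L => T x) this
  have hA : ∀ {a b : V} (f : a ⟶ b) (x : N.Lift),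
      Φ (adjoint (N.liftX f) x) = adjoint (ρ.X f) (Φ x) := by
    intro a b f x
    -- A surjective isometry is unitary, so intertwining the `X_f` implies intertwining their
    -- adjoints.
    refine ext_inner_right ℂ fun y => ?_
    obtain ⟨y, rfl⟩ := hsurj y
    rw [Φ.inner_map_map, adjoint_inner_left, adjoint_inner_left, ← hX, Φ.inner_map_map]
  exact ⟨(LinearIsometryEquiv.ofSurjective Φ hsurj).toContinuousLinearEquiv, fun f =>
    ⟨fun x => hX f x, fun x => hA f x⟩⟩

/-- A complete submodule of `UL` lifts to `L`. -/
theorem PiRep_restrict_isomorphic {S : Submodule ℂ ρ.L} (hS : ρ.toMod.IsCompleteSubmodule S) :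
    (ALMod.restrict hS.toIsSubmodule).PiRep.Isomorphic ρ := by
  let j : (ALMod.restrict hS.toIsSubmodule).H →ₗᵢ[ℂ] ρ.L := S.subtypeₗᵢ
  refine PiRep_isomorphic_of_embedding (j := j) (fun _ _ => rfl) ?_
  have : LinearMap.range j.toLinearMap = S := S.range_subtype
  rw [this]
  exact ((OLRep.isCompleteSubmodule_iff S).1 hS).2.2

end ALMod

/-! ### The copy of `K` inside a representation isomorphic to `Π(K)` -/

namespace ALMod

open scoped Classical
open UniformSpace

variable {k : ℕ} {V : Type u} [Category.{v} V] {Λ : KGraph k V} [Λ.RowFinite]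
variable (K : ALMod.{v, u, w'} Λ)

theorem isClosed_fiber (a : V) : IsClosed (K.fiber a : Set K.H) := by
  have : (K.fiber a : Set K.H) = {x | K.A (𝟙 a) x = x} :=
    Set.ext fun x => ⟨K.A_id_of_mem, fun h => ⟨x, h⟩⟩
  rw [this]
  exact isClosed_eq (K.A (𝟙 a)).continuous continuous_id

theorem orthogonalFamily_fiber :
    OrthogonalFamily ℂ (fun a => K.fiber a) fun a => (K.fiber a).subtypeₗᵢ := by
  intro a b hab x y
  show inner ℂ (x : K.H) (y : K.H) = 0
  rw [← K.A_id_of_mem x.2, ← K.A_id_of_mem y.2, ← adjoint_inner_right,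
    (K.isStarProjection a).isSelfAdjoint.adjoint_eq, ← ContinuousLinearMap.comp_apply,
    K.orthogonal a b hab, zero_apply, inner_zero_right]

theorem finite_fiber_ne_bot (h : FiniteDimensional ℂ K.H) : {a | K.fiber a ≠ ⊥}.Finite :=
  WellFoundedGT.finite_ne_bot_of_iSupIndep K.orthogonalFamily_fiber.independent

theorem degBound_pair_le {a : V} (p : PathInto a) (ξ : K.fiber p.1) :
    K.degBound (K.pair p ξ) ≤ Λ.deg p.2 := by
  refine Finset.sup_le fun q hq => ?_
  have := DFinsupp.support_single_subset hq
  rw [Finset.mem_singleton.1 this]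

theorem cut_id {a : V} (τ : PathInto a) : K.cut ⟨a, 𝟙 a⟩ τ = K.A τ.2 :=
  K.cut_of_eq (p := ⟨a, 𝟙 a⟩) τ.2 (Category.comp_id _)

variable [Λ.LocallyConvex]

theorem inner_pair_id {a : V} (ξ η : K.fiber a) :
    inner ℂ (K.pair ⟨a, 𝟙 a⟩ ξ) (K.pair ⟨a, 𝟙 a⟩ η) = inner ℂ ξ η := by
  have h0 : ∀ ζ : K.fiber a, K.degBound (K.pair ⟨a, 𝟙 a⟩ ζ) ≤ 0 := fun ζ =>
    (K.degBound_pair_le ⟨a, 𝟙 a⟩ ζ).trans (Λ.deg_id a).le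
  rw [inner_eq_ip, K.ip_eq (h0 ξ) (h0 η), form, Λ.leaves_zero, Finset.sum_singleton,
    coord_pair, coord_pair, cut_id]
  show inner ℂ (K.A (𝟙 a) (ξ : K.H)) (K.A (𝟙 a) (η : K.H)) = _
  rw [K.A_id_of_mem ξ.2, K.A_id_of_mem η.2]
  rfl

/-- The isometry `ξ ↦ [a, ξ]` from `K_a` to `L_a`. -/
noncomputable def unitL (a : V) : K.fiber a →ₗᵢ[ℂ] K.LSpace a :=
  (Completion.toComplₗᵢ (𝕜 := ℂ) (E := K.Pre a)).comp
    ((K.pair ⟨a, 𝟙 a⟩).isometryOfInner K.inner_pair_id)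

theorem unitL_apply {a : V} (ξ : K.fiber a) :
    K.unitL a ξ = (K.pair ⟨a, 𝟙 a⟩ ξ : K.Pre a) := rfl

/-- Leaves at `b` that do not pass through `f` contribute nothing, and those of the form `f ∘ σ`
correspond to leaves `σ` at `a`, where `A_{f ∘ σ} ξ = A_σ (A_f ξ)`. This yields `X_f^* [b, ξ] = [a,
A_f ξ]`: the copy of `K` is a submodule of `UΠ(K)`. -/
theorem inner_pair_id_shift {a b : V} (f : a ⟶ b) (ξ : K.fiber b) (y : K.Pre a) :
    inner ℂ (K.pair ⟨b, 𝟙 b⟩ ξ) (K.shift f y) =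
      inner ℂ (K.pair ⟨a, 𝟙 a⟩ ⟨K.A f ξ, K.A_mem_fiber f ξ⟩) y := by
  have h0 : ∀ (c : V) (ζ : K.fiber c) (n : Fin k → ℕ), K.degBound (K.pair ⟨c, 𝟙 c⟩ ζ) ≤ n :=
    fun c ζ n => (K.degBound_pair_le ⟨c, 𝟙 c⟩ ζ).trans ((Λ.deg_id c).le.trans (zero_le (a := n)))
  obtain ⟨n, h1, h2⟩ : ∃ n, K.degBound y ≤ n ∧ K.degBound (K.shift f y) ≤ n :=
    ⟨K.degBound y + K.degBound (K.shift f y), le_self_add, le_add_self⟩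
  rw [inner_eq_ip, inner_eq_ip, K.ip_eq (h0 _ _ _) h1,
    K.ip_eq (h0 _ _ _) (h2.trans (le_self_add (b := Λ.deg f)))]
  unfold form
  have hinj : Function.Injective (PathInto.push f) := Λ.extend_injective ⟨a, f⟩
  rw [← Finset.sum_subset (s₁ := (Λ.leaves a n).image (PathInto.push f)),
    Finset.sum_image fun x _ y _ h => hinj h]
  · refine Finset.sum_congr rfl fun τ _ => ?_
    rw [coord_push, coord_pair, coord_pair, cut_id, cut_id, K.map_comp]
    rfl
  · intro τ hτ
    obtain ⟨σ, hσ, rfl⟩ := Finset.mem_image.1 hτ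
    exact Λ.mem_leaves.2 ((Λ.maximal_push f σ).2 (Λ.mem_leaves.1 hσ))
  · intro τ hτ hn
    rw [K.coord_shift_of_not f τ, inner_zero_right]
    rintro ⟨σ, rfl⟩
    exact hn (Finset.mem_image_of_mem _
      (Λ.mem_leaves.2 ((Λ.maximal_push f σ).1 (Λ.mem_leaves.1 hτ))))

theorem adjoint_LMap_unitL {a b : V} (f : a ⟶ b) (ξ : K.fiber b) :
    adjoint (K.LMap f) (K.unitL b ξ) = K.unitL a ⟨K.A f ξ, K.A_mem_fiber f ξ⟩ := by
  refine ext_inner_right ℂ fun y => ?_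
  rw [adjoint_inner_left]
  refine Completion.induction_on y (isClosed_eq (by fun_prop) (by fun_prop)) fun y => ?_
  rw [LMap_coe, unitL_apply, unitL_apply, Completion.inner_coe, Completion.inner_coe,
    inner_pair_id_shift]

theorem LMap_unitL {a b : V} (f : a ⟶ b) (ξ : K.fiber a) :
    K.LMap f (K.unitL a ξ) = (K.pair ⟨a, f⟩ ξ : K.Pre b) := by
  rw [unitL_apply, LMap_coe, shift_pair]
  congr 1
  exact K.pair_congr (Category.id_comp f) ξ

/-- The isometry `ξ ↦ [a, ξ]` from `K_a` to the lifted representation. -/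
noncomputable def unit (a : V) : K.fiber a →L[ℂ] K.Lift :=
  K.incl a ∘L (K.unitL a).toContinuousLinearMap

theorem norm_unit {a : V} (ξ : K.fiber a) : ‖K.unit a ξ‖ = ‖ξ‖ :=
  (lp.norm_single (by norm_num) a (K.unitL a ξ)).trans ((K.unitL a).norm_map ξ)

theorem adjoint_liftX_unit {a b : V} (f : a ⟶ b) (ξ : K.fiber b) :
    adjoint (K.liftX f) (K.unit b ξ) = K.unit a ⟨K.A f ξ, K.A_mem_fiber f ξ⟩ := by
  rw [adjoint_liftX]
  show K.incl a (adjoint (K.LMap f) (adjoint (K.incl b) (K.incl b (K.unitL b ξ)))) = _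
  rw [proj_incl_self, adjoint_LMap_unitL]
  rfl

theorem liftX_unit {a b : V} (f : a ⟶ b) (ξ : K.fiber a) :
    K.liftX f (K.unit a ξ) = K.incl b (K.pair ⟨a, f⟩ ξ : K.Pre b) := by
  show K.incl b (K.LMap f (adjoint (K.incl a) (K.incl a (K.unitL a ξ)))) = _
  rw [proj_incl_self, LMap_unitL]

theorem liftX_id_unit {a : V} (ξ : K.fiber a) : K.liftX (𝟙 a) (K.unit a ξ) = K.unit a ξ :=
  K.liftX_unit (𝟙 a) ξ

theorem liftX_id_unit_of_ne {a b : V} (h : b ≠ a) (ξ : K.fiber a) :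
    K.liftX (𝟙 b) (K.unit a ξ) = 0 := by
  show K.incl b (K.LMap (𝟙 b) (adjoint (K.incl b) (K.incl a (K.unitL a ξ)))) = _
  rw [proj_incl_of_ne _ h, map_zero, map_zero]

variable {K} {ρ : OLRep.{v, u, w} Λ} (φ : K.Lift ≃L[ℂ] ρ.L)

/-- The image of `K_a` in `L` under an identification of `L` with the lift of `K`. -/
noncomputable def unitRange (a : V) : Submodule ℂ ρ.L :=
  LinearMap.range (φ.toContinuousLinearMap ∘L K.unit a).toLinearMap

/-- The image of `K` in `L`: the vectors all of whose components lie in the images of the `K_a`. -/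
noncomputable def image : Submodule ℂ ρ.L :=
  -- As an intersection of preimages of closed subspaces this is closed for every `K`, even with
  -- infinitely many nonzero fibres.
  ⨅ a : V, (unitRange φ a).comap (ρ.X (𝟙 a)).toLinearMap

variable {φ}

theorem mem_image {x : ρ.L} : x ∈ image φ ↔ ∀ a, ρ.X (𝟙 a) x ∈ unitRange φ a := by
  simp [image, Submodule.mem_iInf]

theorem mem_unitRange {a : V} {x : ρ.L} :
    x ∈ unitRange φ a ↔ ∃ ξ, φ (K.unit a ξ) = x := Iff.rfl

theorem isClosed_unitRange (a : V) : IsClosed (unitRange φ a : Set ρ.L) := by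
  have : CompleteSpace (K.fiber a) := (K.isClosed_fiber a).completeSpace_coe
  have h1 : Isometry (K.unit a) := AddMonoidHomClass.isometry_of_norm _ K.norm_unit
  have h2 : IsClosed (Set.range (φ ∘ K.unit a)) := by
    rw [Set.range_comp]
    exact (φ.toHomeomorph.isClosed_image).2 h1.isClosedEmbedding.isClosed_range
  exact h2

theorem isClosed_image : IsClosed (image φ : Set ρ.L) := by
  have : (image φ : Set ρ.L) = ⋂ a : V, ρ.X (𝟙 a) ⁻¹' (unitRange φ a : Set ρ.L) := by
    ext x
    simp only [SetLike.mem_coe, mem_image, Set.mem_iInter, Set.mem_preimage]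
  rw [this]
  exact isClosed_iInter fun a => (isClosed_unitRange a).preimage (ρ.X (𝟙 a)).continuous

theorem map_unit_mem_image (hX : ∀ {a b : V} (f : a ⟶ b) (x : K.Lift),
    φ (K.liftX f x) = ρ.X f (φ x)) {a : V} (ξ : K.fiber a) : φ (K.unit a ξ) ∈ image φ := by
  refine mem_image.2 fun b => ?_
  rw [← hX]
  by_cases h : b = a
  · subst h
    rw [liftX_id_unit]
    exact ⟨ξ, rfl⟩
  · rw [liftX_id_unit_of_ne K h, map_zero]
    exact zero_mem _

/-- Invariance is `X_f^* [b, ξ] = [a, A_f ξ]`, and generation is `[λ, ξ] = X_λ [s(λ), ξ]`. `K` may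
have infinite dimension, as the minimum over all modules requires. -/
theorem isCompleteSubmodule_image (hX : ∀ {a b : V} (f : a ⟶ b) (x : K.Lift),
      φ (K.liftX f x) = ρ.X f (φ x))
    (hA : ∀ {a b : V} (f : a ⟶ b) (x : K.Lift),
      φ (adjoint (K.liftX f) x) = adjoint (ρ.X f) (φ x)) :
    ρ.toMod.IsCompleteSubmodule (image φ) := by
  refine (OLRep.isCompleteSubmodule_iff _).2 ⟨isClosed_image, fun {a b} f x hx => ?_, ?_⟩
  · refine mem_image.2 fun c => ?_
    by_cases h : c = a
    · subst h
      obtain ⟨ξ, hξ⟩ := mem_unitRange.1 (mem_image.1 hx b)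
      rw [ρ.X_id_adjoint, ← ρ.adjoint_X_X_id, ← hξ, ← hA, adjoint_liftX_unit]
      exact ⟨_, rfl⟩
    · rw [ρ.X_id_adjoint_of_ne f h]
      exact zero_mem _
  · set R := (ρ.genSpan (image φ)).topologicalClosure
    have hcl : IsClosed (R : Set ρ.L) := Submodule.isClosed_topologicalClosure _
    have : CompleteSpace R := hcl.completeSpace_coe
    -- Density is expressed as the vanishing of a continuous map on `Π(K)`, which can be tested on
    -- the vectors `[λ, ξ]`.
    have h1 : Rᗮ.starProjection ∘L φ.toContinuousLinearMap = 0 := by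
      refine K.lift_hom_ext fun b p ξ => ?_
      show Rᗮ.starProjection (φ (K.incl b (K.pair p ξ : K.Pre b))) = 0
      rw [Submodule.starProjection_apply_eq_zero_iff, Submodule.orthogonal_orthogonal,
        ← K.liftX_unit p.2 ξ, hX]
      exact subset_closure (OLRep.X_mem_genSpan p.2 (map_unit_mem_image hX ξ))
    refine eq_top_iff.2 fun x _ => ?_
    have h2 := congrArg (fun T : K.Lift →L[ℂ] ρ.L => T (φ.symm x)) h1
    have h3 : Rᗮ.starProjection (φ (φ.symm x)) = 0 := h2
    rwa [φ.apply_symm_apply, Submodule.starProjection_apply_eq_zero_iff,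
      Submodule.orthogonal_orthogonal] at h3

theorem finiteDimensional_image (hK : FiniteDimensional ℂ K.H) :
    FiniteDimensional ℂ (image φ) := by
  have hfin := K.finite_fiber_ne_bot hK
  have hbot : ∀ a, a ∉ hfin.toFinset → unitRange φ a = ⊥ := by
    intro a ha
    have h : K.fiber a = ⊥ := by simpa using ha
    rw [eq_bot_iff]
    rintro _ ⟨ξ, rfl⟩
    have : ξ = 0 := Subtype.ext ((Submodule.eq_bot_iff _).1 h ξ ξ.2)
    rw [this, map_zero]
    exact zero_mem _
  have : ∀ a, FiniteDimensional ℂ (unitRange φ a) := fun a =>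
    LinearMap.finiteDimensional_range _
  -- Only finitely many fibres of `K` are nonzero, so a vector of the image is a finite sum of its
  -- components.
  have hle : image φ ≤ hfin.toFinset.sup (unitRange φ) := by
    intro x hx
    have hx' := mem_image.1 hx
    have h1 : x = ∑ a ∈ hfin.toFinset, ρ.X (𝟙 a) x :=
      (ρ.nondegenerate x).unique (hasSum_sum_of_ne_finset_zero fun a ha => by
        have := hx' a
        rwa [hbot a ha, Submodule.mem_bot] at this)
    rw [h1]
    exact Submodule.sum_mem _ fun a ha => Finset.le_sup (f := unitRange φ) ha (hx' a)
  have := Submodule.finiteDimensional_finset_sup hfin.toFinset (unitRange φ)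
  exact Submodule.finiteDimensional_of_le hle

end ALMod

/-! ### Comparison of dimension vectors -/

namespace ALMod

variable {k : ℕ} {V : Type u} [Category.{v} V] {Λ : KGraph k V} [Λ.RowFinite]

theorem dimVec_restrict {M : ALMod.{v, u, w} Λ} {S : Submodule ℂ M.H} (hS : M.IsSubmodule S)
    (a : V) : (restrict hS).dimVec a =
      Cardinal.toENat (Module.rank ℂ (S ⊓ M.fiber a : Submodule ℂ M.H)) := by
  let j : (restrict hS).H →ₗ[ℂ] M.H := S.subtype
  have hj : Function.Injective j := S.injective_subtype
  have h : ((restrict hS).fiber a).map j = S ⊓ M.fiber a := by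
    ext x
    constructor
    · rintro ⟨y, ⟨z, rfl⟩, rfl⟩
      exact ⟨((restrict hS).A (𝟙 a) z).2, z.1, rfl⟩
    · rintro ⟨hx, hx'⟩
      exact ⟨⟨x, hx⟩, ⟨⟨x, hx⟩, Subtype.ext (M.A_id_of_mem hx')⟩, rfl⟩
  rw [dimVec, ← h]
  exact congrArg _ (LinearEquiv.rank_eq (Submodule.equivMapOfInjective j hj _))

theorem dimVec_restrict_mono {M : ALMod.{v, u, w} Λ} {S T : Submodule ℂ M.H}
    (hS : M.IsSubmodule S) (hT : M.IsSubmodule T) (h : S ≤ T) :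
    (restrict hS).dimVec ≤ (restrict hT).dimVec := by
  intro a
  rw [dimVec_restrict, dimVec_restrict]
  exact Cardinal.toENat.monotone' (Submodule.rank_mono (inf_le_inf_right _ h))

/-- A vector of the image that lies over `a` equals its own component at `a`, hence comes from
`K_a`. -/
theorem dimVec_restrict_image_le [Λ.LocallyConvex] {K : ALMod.{v, u, w} Λ}
    {ρ : OLRep.{v, u, w} Λ} {φ : K.Lift ≃L[ℂ] ρ.L} (hS : ρ.toMod.IsSubmodule (image φ)) :
    (restrict hS).dimVec ≤ K.dimVec := by
  intro a
  refine (dimVec_restrict hS a).trans_le (Cardinal.toENat.monotone' ?_)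
  have h1 : (image φ ⊓ ρ.toMod.fiber a : Submodule ℂ ρ.L) ≤ unitRange φ a := by
    rintro x ⟨hx, hx'⟩
    have := mem_image.1 hx a
    rwa [OLRep.mem_fiber_toMod.1 hx'] at this
  exact (Submodule.rank_mono h1).trans (rank_range_le _)

end ALMod

/-! ### Invariance under isomorphism -/

namespace OLRep

variable {k : ℕ} {V : Type u} [Category.{v} V] {Λ : KGraph k V} [Λ.RowFinite]

theorem intertwines_symm {ρ : OLRep.{v, u, w} Λ} {σ : OLRep.{v, u, w'} Λ} {φ : ρ.L ≃L[ℂ] σ.L}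
    (hφ : ∀ {a b : V} (f : a ⟶ b), (∀ x, φ (ρ.X f x) = σ.X f (φ x)) ∧
      ∀ x, φ (adjoint (ρ.X f) x) = adjoint (σ.X f) (φ x)) {a b : V} (f : a ⟶ b) :
    (∀ x, φ.symm (σ.X f x) = ρ.X f (φ.symm x)) ∧
      ∀ x, φ.symm (adjoint (σ.X f) x) = adjoint (ρ.X f) (φ.symm x) := by
  constructor <;> intro x <;> apply φ.injective
  · rw [(hφ f).1, φ.apply_symm_apply, φ.apply_symm_apply]
  · rw [(hφ f).2, φ.apply_symm_apply, φ.apply_symm_apply]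

theorem mem_sigmaSpace {ρ : OLRep.{v, u, w} Λ} {x : ρ.L} :
    x ∈ (ρ.sigmaSpace : Submodule ℂ ρ.L) ↔
      ∀ S : Submodule ℂ ρ.L, ρ.toMod.IsCompleteSubmodule S → x ∈ S :=
  Submodule.mem_sInf (M := ρ.toMod.H)

variable [Λ.LocallyConvex]

/-- Isomorphisms of representations map complete submodules to complete submodules. -/
theorem IsCompleteSubmodule.map {ρ : OLRep.{v, u, w} Λ} {σ : OLRep.{v, u, w'} Λ}
    {φ : ρ.L ≃L[ℂ] σ.L} (hφ : ∀ {a b : V} (f : a ⟶ b), (∀ x, φ (ρ.X f x) = σ.X f (φ x)) ∧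
      ∀ x, φ (adjoint (ρ.X f) x) = adjoint (σ.X f) (φ x))
    {S : Submodule ℂ ρ.L} (hS : ρ.toMod.IsCompleteSubmodule S) :
    σ.toMod.IsCompleteSubmodule (S.map φ.toLinearEquiv.toLinearMap : Submodule ℂ σ.L) := by
  obtain ⟨h1, h2, h3⟩ := (isCompleteSubmodule_iff S).1 hS
  refine (isCompleteSubmodule_iff _).2 ⟨(φ.toHomeomorph.isClosed_image).2 h1, ?_, ?_⟩
  · rintro a b f _ ⟨x, hx, rfl⟩
    exact ⟨_, h2 f x hx, (hφ f).2 x⟩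
  · refine eq_top_iff.2 fun y _ => ?_
    obtain ⟨x, rfl⟩ := φ.surjective y
    have hx : x ∈ (ρ.genSpan S).topologicalClosure := h3 ▸ Submodule.mem_top
    have hle : ρ.genSpan S ≤ (σ.genSpan (S.map φ.toLinearEquiv.toLinearMap)).comap
        φ.toLinearEquiv.toLinearMap := by
      refine Submodule.span_le.2 ?_
      rintro _ ⟨a, b, f, η, hη, rfl⟩
      show φ (ρ.X f η) ∈ σ.genSpan _
      rw [(hφ f).1]
      exact X_mem_genSpan f ⟨η, hη, rfl⟩
    exact map_mem_closure φ.continuous hx hle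

theorem map_mem_sigmaSpace {ρ : OLRep.{v, u, w} Λ} {σ : OLRep.{v, u, w'} Λ}
    {φ : ρ.L ≃L[ℂ] σ.L} (hφ : ∀ {a b : V} (f : a ⟶ b), (∀ x, φ (ρ.X f x) = σ.X f (φ x)) ∧
      ∀ x, φ (adjoint (ρ.X f) x) = adjoint (σ.X f) (φ x)) {y : σ.L}
    (hy : y ∈ (σ.sigmaSpace : Submodule ℂ σ.L)) :
    φ.symm y ∈ (ρ.sigmaSpace : Submodule ℂ ρ.L) := by
  refine mem_sigmaSpace.2 fun S hS => ?_
  obtain ⟨x, hx, rfl⟩ := mem_sigmaSpace.1 hy _ (IsCompleteSubmodule.map hφ hS)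
  have h : φ.symm (φ x) ∈ S := by rw [φ.symm_apply_apply]; exact hx
  exact h

theorem Isomorphic.dimVec_sigmaMod {ρ : OLRep.{v, u, w} Λ} {σ : OLRep.{v, u, w'} Λ}
    (h : ρ.Isomorphic σ) : σ.SigmaMod.dimVec = ρ.SigmaMod.dimVec := by
  obtain ⟨φ, hφ⟩ := h
  funext a
  refine (ALMod.dimVec_restrict σ.sigmaSpace_isSubmodule a).trans
    (Eq.trans ?_ (ALMod.dimVec_restrict ρ.sigmaSpace_isSubmodule a).symm)
  let S : Submodule ℂ ρ.L := ρ.sigmaSpace ⊓ ρ.toMod.fiber a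
  let T : Submodule ℂ σ.L := σ.sigmaSpace ⊓ σ.toMod.fiber a
  have hmap : S.map φ.toLinearEquiv.toLinearMap = T := by
    ext y
    constructor
    · rintro ⟨x, ⟨hx, hx'⟩, rfl⟩
      refine ⟨?_, mem_fiber_toMod.2 ?_⟩
      · exact map_mem_sigmaSpace (φ := φ.symm) (intertwines_symm hφ) hx
      · exact ((hφ (𝟙 a)).1 x).symm.trans (congrArg φ (mem_fiber_toMod.1 hx'))
    · rintro ⟨hy, hy'⟩
      refine ⟨φ.symm y, ⟨map_mem_sigmaSpace hφ hy, mem_fiber_toMod.2 ?_⟩, φ.apply_symm_apply y⟩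
      exact ((intertwines_symm hφ (𝟙 a)).1 y).symm.trans
        (congrArg φ.symm (mem_fiber_toMod.1 hy'))
  have h1 := LinearEquiv.lift_rank_eq (φ.toLinearEquiv.submoduleMap S)
  rw [hmap] at h1
  have h2 := congrArg Cardinal.toENat h1
  rw [Cardinal.toENat_lift, Cardinal.toENat_lift] at h2
  exact h2.symm

end OLRep

/-! ### The Pythagorean dimension vector -/

theorem mainTheorem6 {k : ℕ} {V : Type u} [Category.{v} V] (Λ : KGraph k V)
    [Λ.RowFinite] [Λ.LocallyConvex] (ρ : OLRep.{v, u, w} Λ) (hρ : ρ.FinitePDim) :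
    -- `Σ(L)` is well defined: there is a smallest complete submodule of `UL`
    IsLeast {S | ρ.toMod.IsCompleteSubmodule S} ρ.sigmaSpace ∧
    -- `dim_Λ Σ(L)` is the coordinatewise minimum of the `dim_Λ K` with `Π(K) ≅ L`
    IsLeast {d : V → ℕ∞ | ∃ K : ALMod.{v, u, w} Λ, K.PiRep.Isomorphic ρ ∧ K.dimVec = d}
      ρ.SigmaMod.dimVec ∧
    -- and the coordinatewise minimum over the complete submodules of `UL`
    IsLeast {d : V → ℕ∞ | ∃ (S : Submodule ℂ ρ.toMod.H) (hS : ρ.toMod.IsCompleteSubmodule S),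
      (ALMod.restrict hS.toIsSubmodule).dimVec = d} ρ.SigmaMod.dimVec ∧
    -- the common vector is an isomorphism invariant
    ∀ ρ' : OLRep.{v, u, w'} Λ, ρ.Isomorphic ρ' → ρ'.SigmaMod.dimVec = ρ.SigmaMod.dimVec := by
  have hleast : IsLeast {S | ρ.toMod.IsCompleteSubmodule S} ρ.sigmaSpace := by
    obtain ⟨K, hK, φ, hφ⟩ := hρ
    exact OLRep.isLeast_sigmaSpace (ALMod.isCompleteSubmodule_image (φ := φ)
      (fun f => (hφ f).1) (fun f => (hφ f).2)) (ALMod.finiteDimensional_image hK)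
  have hle : ∀ {S : Submodule ℂ ρ.toMod.H} (hS : ρ.toMod.IsCompleteSubmodule S),
      ρ.SigmaMod.dimVec ≤ (ALMod.restrict hS.toIsSubmodule).dimVec := fun hS =>
    ALMod.dimVec_restrict_mono _ _ (hleast.2 hS)
  refine ⟨hleast, ⟨⟨ρ.SigmaMod, ALMod.PiRep_restrict_isomorphic hleast.1, rfl⟩, ?_⟩,
    ⟨⟨ρ.sigmaSpace, hleast.1, rfl⟩, ?_⟩, fun ρ' h => h.dimVec_sigmaMod⟩
  · rintro _ ⟨K, ⟨φ, hφ⟩, rfl⟩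
    -- An arbitrary `K` with `Π(K) ≃ L` is compared with `Σ(L)` through its copy in `L`, a complete
    -- submodule of no larger dimension vector.
    have hS := ALMod.isCompleteSubmodule_image (φ := φ) (fun f => (hφ f).1) (fun f => (hφ f).2)
    exact (hle hS).trans (ALMod.dimVec_restrict_image_le hS.toIsSubmodule)
  · rintro _ ⟨S, hS, rfl⟩
    exact hle hS
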